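/- Let $A\in\mathbb R^{n\times n}$, $C\in\mathbb R^{p\times n}$, $D\in\mathbb R^{p\times m}$, let $Q\in\mathbb R^{n\times n}$ be symmetric positive semidefinite and $R\in\mathbb R^{p\times p}$ symmetric positive definite, and suppose that $(A,Q^{1/2})$ is stabilizable and $(A,C)$ is detectable. Consider, for $t\ge 0$, the noise-free system $$\dot x_t=Ax_t,\qquad y_t=Cx_t+Dd_t,$$ with an outlier signal $d_t\in\mathbb R^m$ such that $\|d_t\|\le\mu<\infty$ for all $t\ge0$ (Euclidean norm), and the innovation-saturated Kalman filter $$\dot{\hat x}_t=A\hat x_t+K_t\,\mathrm{sat}_{\sigma_t}(y_t-C\hat x_t),\qquad K_t=P_tC^\top R^{-1},\qquad \dot P_t=AP_t+P_tA^\top+Q-K_tRK_t^\top,$$ where $P_0$ is symmetric positive definite. Here $\mathrm{sat}_{\sigma}(r)$ is the vector with components $\max\{-\sqrt{\sigma_i},\min\{\sqrt{\sigma_i},r_i\}\}$, and for $i=1,\dots,p$ $$\dot\sigma_{i,t}=\lambda_{1,i}\sigma_{i,t}+\gamma_{1,i}\,\varepsilon_{i,t}e^{-\varepsilon_{i,t}},\qquad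 \dot\varepsilon_{i,t}=\lambda_{2,i}\varepsilon_{i,t}+\gamma_{2,i}\,(y_{i,t}-(C\hat x_t)_i)^2,$$ with $\sigma_{i,0}>0$, $\varepsilon_{i,0}>0$, $\gamma_{1,i},\gamma_{2,i}>0$ and $\lambda_{1,i},\lambda_{2,i}<0$. The function $P$ is a solution of its equation on $[0,\infty)$; the functions $x,\hat x,\sigma,\varepsilon$ are locally absolutely continuous on $[0,\infty)$ and satisfy their equations for almost every $t\ge0$ (classical solutions are a special case). Let $\Gamma_2=\mathrm{diag}(\gamma_{2,1},\dots,\gamma_{2,p})$ and $$M_t=P_t^{-1}QP_t^{-1}+C^\top(R^{-1}-\Gamma_2)C .$$ Let $W$ be a diagonal positive definite $p\times p$ matrix, $U$ a symmetric positive definite $m\times m$ matrix, and $\alpha$ a scalar with $0<\alpha\le-\max\{\lambda_{1,i},\lambda_{2,i}\}$ for $i=1,\dots,p$. Suppose that for every $t\ge0$ the symmetric block matrix $$S_t=\begin{bmatrix}M_t-\alpha P_t^{-1}&-C^\top(R^{-1}+W)&C^\top(\Gamma_2-R^{-1})D\\ \star&2W&WD\\ \star&\star&U\end{bmatrix}$$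 is positive semidefinite. Put $e_t=\hat x_t-x_t$, $\rho=e^{-1}\sum_i\gamma_{1,i}$, $V_0=e_0^\top P_0^{-1}e_0+\sum_i\sigma_{i,0}+\sum_i\varepsilon_{i,0}$, $c_1=\lambda_{\max}(U+D^\top\Gamma_2D)$. Then: (i) for every $t\ge0$ the matrix $P_t$ is positive definite and, with $c_2=c_2(t)=\lambda_{\min}(P_t^{-1})$, $$\|e_t\|\le\sqrt{\frac1{c_2}\Big[e^{-\alpha t}V_0+\frac1\alpha(1-e^{-\alpha t})(c_1\mu^2+\rho)\Big]};$$ (ii) as $t\to\infty$, $P_t$ converges to a matrix $P_\infty$ which is the unique positive definite solution of $AP_\infty+P_\infty A^\top+Q-P_\infty C^\top R^{-1}CP_\infty=0$, the error $e_t$ remains bounded, and with $c_3=\lambda_{\min}(P_\infty^{-1})$, $$\limsup_{t\to\infty}\|e_t\|\le\sqrt{\frac{c_1\mu^2+\rho}{\alpha c_3}}.$$ -/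

import Mathlib

open scoped Matrix
open Filter Topology MeasureTheory

namespace ISKF

/-- A real square matrix is Hurwitz if all its complex eigenvalues have negative real part. -/
def IsHurwitz {n : ℕ} (A : Matrix (Fin n) (Fin n) ℝ) : Prop :=
  ∀ z ∈ spectrum ℂ (A.map (fun a : ℝ => (a : ℂ))), z.re < 0

/-- `(A, B)` is stabilizable: some state feedback makes `A + B F` Hurwitz. -/
def IsStabilizable {n k : ℕ} (A : Matrix (Fin n) (Fin n) ℝ) (B : Matrix (Fin n) (Fin k) ℝ) :
    Prop :=
  ∃ F : Matrix (Fin k) (Fin n) ℝ, IsHurwitz (A + B * F)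

/-- `(A, C)` is detectable: some output injection makes `A + L C` Hurwitz. -/
def IsDetectable {n p : ℕ} (A : Matrix (Fin n) (Fin n) ℝ) (C : Matrix (Fin p) (Fin n) ℝ) :
    Prop :=
  ∃ L : Matrix (Fin n) (Fin p) ℝ, IsHurwitz (A + L * C)

open scoped MatrixOrder in
/-- The positive semidefinite square root of a positive semidefinite matrix. -/
noncomputable def sqrtMat {n : ℕ} (Q : Matrix (Fin n) (Fin n) ℝ) : Matrix (Fin n) (Fin n) ℝ :=
  CFC.sqrt Q

/-- Smallest eigenvalue of a real symmetric matrix. -/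
noncomputable def minEig {n : ℕ} (M : Matrix (Fin n) (Fin n) ℝ) : ℝ := sInf (spectrum ℝ M)

/-- Largest eigenvalue of a real symmetric matrix. -/
noncomputable def maxEig {n : ℕ} (M : Matrix (Fin n) (Fin n) ℝ) : ℝ := sSup (spectrum ℝ M)

/-- Euclidean norm of a vector of `ℝⁿ`. -/
noncomputable def norm2 {n : ℕ} (v : Fin n → ℝ) : ℝ := ‖WithLp.toLp 2 v‖

/-- Scalar saturation `sat_s(r) = max {-s, min {s, r}}`. -/
noncomputable def sat (s r : ℝ) : ℝ := max (-s) (min s r)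

/-- Componentwise saturation of a vector, the `i`-th component at level `√σᵢ`. -/
noncomputable def satVec {p : ℕ} (σ r : Fin p → ℝ) : Fin p → ℝ :=
  fun i => sat (Real.sqrt (σ i)) (r i)

/-- `f` solves `ḟ = g` on `[0, ∞)` in the sense of Carathéodory: `f` is locally absolutely
continuous and the equation holds at almost every time. -/
def Solves (f g : ℝ → ℝ) : Prop :=
  (∀ T : ℝ, 0 ≤ T → AbsolutelyContinuousOnInterval f 0 T) ∧
    ∀ᵐ t : ℝ, 0 ≤ t → HasDerivAt f (g t) t

/-- The filter gain `K = P Cᵀ R⁻¹`. -/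
noncomputable def gain {n p : ℕ} (C : Matrix (Fin p) (Fin n) ℝ) (R : Matrix (Fin p) (Fin p) ℝ)
    (P : Matrix (Fin n) (Fin n) ℝ) : Matrix (Fin n) (Fin p) ℝ :=
  P * Cᵀ * R⁻¹

/-- `P` solves `Ṗ = A P + P Aᵀ + Q - K R Kᵀ`, `K = P Cᵀ R⁻¹`, on `[0, ∞)`. -/
def IsRiccatiSolution {n p : ℕ} (A : Matrix (Fin n) (Fin n) ℝ) (C : Matrix (Fin p) (Fin n) ℝ)
    (Q : Matrix (Fin n) (Fin n) ℝ) (R : Matrix (Fin p) (Fin p) ℝ)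
    (P : ℝ → Matrix (Fin n) (Fin n) ℝ) : Prop :=
  ∀ t : ℝ, 0 ≤ t → ∀ i j, HasDerivWithinAt (fun s => P s i j)
    ((A * P t + P t * Aᵀ + Q - gain C R (P t) * R * (gain C R (P t))ᵀ) i j) (Set.Ici 0) t

/-- `X` is a positive definite solution of `A X + X Aᵀ + Q - X Cᵀ R⁻¹ C X = 0`. -/
def IsPosDefARESolution {n p : ℕ} (A : Matrix (Fin n) (Fin n) ℝ) (C : Matrix (Fin p) (Fin n) ℝ)
    (Q : Matrix (Fin n) (Fin n) ℝ) (R : Matrix (Fin p) (Fin p) ℝ)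
    (X : Matrix (Fin n) (Fin n) ℝ) : Prop :=
  X.PosDef ∧ A * X + X * Aᵀ + Q - X * Cᵀ * R⁻¹ * C * X = 0

/-- The measurement `y = C x + D d`. -/
def output {n p m : ℕ} (C : Matrix (Fin p) (Fin n) ℝ) (D : Matrix (Fin p) (Fin m) ℝ)
    (x : Fin n → ℝ) (d : Fin m → ℝ) : Fin p → ℝ :=
  C *ᵥ x + D *ᵥ d

/-- A joint trajectory of the noise-free plant `ẋ = A x`, `y = C x + D d` and of the
innovation-saturated Kalman filter with gain `K_t = P_t Cᵀ R⁻¹` and adaptive saturation bounds. -/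
structure IsTrajectory {n p m : ℕ} (A : Matrix (Fin n) (Fin n) ℝ) (C : Matrix (Fin p) (Fin n) ℝ)
    (D : Matrix (Fin p) (Fin m) ℝ) (R : Matrix (Fin p) (Fin p) ℝ)
    (lam1 lam2 γ1 γ2 : Fin p → ℝ) (P : ℝ → Matrix (Fin n) (Fin n) ℝ) (d : ℝ → Fin m → ℝ)
    (x xhat : ℝ → Fin n → ℝ) (σ ε : ℝ → Fin p → ℝ) : Prop where
  /-- plant -/
  state : ∀ i, Solves (fun t => x t i) (fun t => (A *ᵥ x t) i)
  /-- estimate -/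
  estimate : ∀ i, Solves (fun t => xhat t i) (fun t =>
    (A *ᵥ xhat t + gain C R (P t) *ᵥ satVec (σ t) (output C D (x t) (d t) - C *ᵥ xhat t)) i)
  /-- saturation bounds -/
  bound : ∀ i, Solves (fun t => σ t i) (fun t =>
    lam1 i * σ t i + γ1 i * ε t i * Real.exp (-(ε t i)))
  /-- innovation monitors -/
  monitor : ∀ i, Solves (fun t => ε t i) (fun t =>
    lam2 i * ε t i + γ2 i * ((output C D (x t) (d t) - C *ᵥ xhat t) i) ^ 2)
  bound_init : ∀ i, 0 < σ 0 i
  monitor_init : ∀ i, 0 < ε 0 i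

/-- The matrix `M = P⁻¹ Q P⁻¹ + Cᵀ (R⁻¹ - Γ₂) C`, with `Γ₂ = diag γ₂`. -/
noncomputable def matM {n p : ℕ} (C : Matrix (Fin p) (Fin n) ℝ) (Q : Matrix (Fin n) (Fin n) ℝ)
    (R : Matrix (Fin p) (Fin p) ℝ) (γ2 : Fin p → ℝ) (P : Matrix (Fin n) (Fin n) ℝ) :
    Matrix (Fin n) (Fin n) ℝ :=
  P⁻¹ * Q * P⁻¹ + Cᵀ * (R⁻¹ - Matrix.diagonal γ2) * C

/-- The symmetric `3 × 3` block matrix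
`[M - α P⁻¹, -Cᵀ(R⁻¹ + W), Cᵀ(Γ₂ - R⁻¹)D; ⋆, 2W, WD; ⋆, ⋆, U]`, with `W = diag w`. -/
noncomputable def matS {n p m : ℕ} (C : Matrix (Fin p) (Fin n) ℝ) (D : Matrix (Fin p) (Fin m) ℝ)
    (Q : Matrix (Fin n) (Fin n) ℝ) (R : Matrix (Fin p) (Fin p) ℝ) (γ2 w : Fin p → ℝ)
    (U : Matrix (Fin m) (Fin m) ℝ) (α : ℝ) (P : Matrix (Fin n) (Fin n) ℝ) :
    Matrix (Fin n ⊕ (Fin p ⊕ Fin m)) (Fin n ⊕ (Fin p ⊕ Fin m)) ℝ :=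
  let B12 : Matrix (Fin n) (Fin p) ℝ := -(Cᵀ * (R⁻¹ + Matrix.diagonal w))
  let B13 : Matrix (Fin n) (Fin m) ℝ := Cᵀ * (Matrix.diagonal γ2 - R⁻¹) * D
  let B23 : Matrix (Fin p) (Fin m) ℝ := Matrix.diagonal w * D
  Matrix.fromBlocks (matM C Q R γ2 P - α • P⁻¹) (Matrix.fromCols B12 B13)
    (Matrix.fromRows B12ᵀ B13ᵀ)
    (Matrix.fromBlocks ((2 : ℝ) • Matrix.diagonal w) B23 B23ᵀ U)

/-- The Lyapunov value `V = eᵀ P⁻¹ e + ∑ σᵢ + ∑ εᵢ`. -/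
noncomputable def lyap {n p : ℕ} (P : Matrix (Fin n) (Fin n) ℝ) (e : Fin n → ℝ)
    (σ ε : Fin p → ℝ) : ℝ :=
  e ⬝ᵥ (P⁻¹ *ᵥ e) + ∑ i, σ i + ∑ i, ε i

/-- The constant `c₁`, the largest eigenvalue of `U + Dᵀ Γ₂ D`. -/
noncomputable def c₁ {p m : ℕ} (D : Matrix (Fin p) (Fin m) ℝ) (γ2 : Fin p → ℝ)
    (U : Matrix (Fin m) (Fin m) ℝ) : ℝ :=
  maxEig (U + Dᵀ * Matrix.diagonal γ2 * D)

/-- The constant `ρ = e⁻¹ ∑ γ₁ᵢ`. -/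
noncomputable def rho {p : ℕ} (γ1 : Fin p → ℝ) : ℝ := Real.exp (-1) * ∑ i, γ1 i

end ISKF

namespace ISKF

/-! ### Quadratic forms, traces of products and extreme eigenvalues. -/

section LinearAlgebra

variable {n p m : ℕ}

/-! The matrix inequality `S_t ≥ 0` is used twice.

Its upper left block, after adding `Cᵀ Γ₂ C`, gives `P⁻¹QP⁻¹ + G ≥ αP⁻¹` with `G = CᵀR⁻¹C`. This
alone controls the Riccati flow. Measure `Ṗ` in the invariant metric of the positive definite cone,
by `tr(P⁻¹ṖP⁻¹Ṗ)`; the derivative of this quantity is `-2 tr((P⁻¹QP⁻¹ + G)ṖP⁻¹Ṗ)`, so it decays like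
`e^{-2αt}` (`RiccatiFlow.speedSq_le`). The curve thus has finite length, and by Cauchy-Schwarz each
`log(vᵀPv)` has a derivative bounded by a constant times `e^{-αt}`. Hence `P` cannot reach the
boundary of the cone (`RiccatiFlow.posDef`), and it converges to a positive definite matrix at which
the field vanishes (`RiccatiFlow.exists_tendsto`). The inequality passes to the limit, where a trace
identity excludes a second positive definite equilibrium (`riccati_unique`).

The whole of `S_t` gives the error bound, with `V = eᵀP⁻¹e + ∑σᵢ + ∑εᵢ`. The saturation and its dead
zone have the same sign in each component, so the form of `S_t` at (error, minus dead zone, outlier)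
bounds the derivative of `eᵀP⁻¹e` together with the input of the monitors (`quad_dissipation`). As
`xe^{-x} ≤ e^{-1}` and `σ, ε > 0`, one gets `V̇ ≤ -αV + c₁μ² + ρ`. Grönwall's inequality for
absolutely continuous functions bounds `V`, hence `‖e‖` through the least eigenvalue of `P⁻¹`. -/

lemma isHermitian_iff_transpose {M : Matrix (Fin n) (Fin n) ℝ} : M.IsHermitian ↔ Mᵀ = M := by
  rw [Matrix.IsHermitian, Matrix.conjTranspose_eq_transpose_of_trivial]

lemma PosSemidef.quad_nonneg {ι : Type*} [Fintype ι] {M : Matrix ι ι ℝ} (hM : M.PosSemidef)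
    (v : ι → ℝ) : 0 ≤ v ⬝ᵥ (M *ᵥ v) := by
  simpa using hM.dotProduct_mulVec_nonneg v

lemma PosDef.quad_pos {M : Matrix (Fin n) (Fin n) ℝ} (hM : M.PosDef)
    {v : Fin n → ℝ} (hv : v ≠ 0) : 0 < v ⬝ᵥ (M *ᵥ v) := by
  simpa using hM.dotProduct_mulVec_pos hv

lemma posSemidef_of_quad {M : Matrix (Fin n) (Fin n) ℝ} (hs : Mᵀ = M)
    (h : ∀ v, 0 ≤ v ⬝ᵥ (M *ᵥ v)) : M.PosSemidef :=
  .of_dotProduct_mulVec_nonneg (isHermitian_iff_transpose.2 hs) (by simpa using h)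

lemma posDef_of_quad {M : Matrix (Fin n) (Fin n) ℝ} (hs : Mᵀ = M)
    (h : ∀ v, v ≠ 0 → 0 < v ⬝ᵥ (M *ᵥ v)) : M.PosDef :=
  .of_dotProduct_mulVec_pos (isHermitian_iff_transpose.2 hs) (by simpa using h)

/-- Quadratic forms commute with transposition. -/
lemma quad_transpose (M : Matrix (Fin n) (Fin p) ℝ) (u : Fin p → ℝ) (v : Fin n → ℝ) :
    u ⬝ᵥ (Mᵀ *ᵥ v) = v ⬝ᵥ (M *ᵥ u) := by
  rw [Matrix.mulVec_transpose, dotProduct_comm, ← Matrix.dotProduct_mulVec]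

open scoped MatrixOrder in
lemma PosSemidef.exists_eq_transpose_mul_self {M : Matrix (Fin n) (Fin n) ℝ}
    (hM : M.PosSemidef) : ∃ B : Matrix (Fin n) (Fin n) ℝ, M = Bᵀ * B := by
  obtain ⟨B, hB⟩ := CStarAlgebra.nonneg_iff_eq_star_mul_self.mp hM.nonneg
  exact ⟨B, by rw [hB, Matrix.star_eq_conjTranspose, Matrix.conjTranspose_eq_transpose_of_trivial]⟩

lemma PosSemidef.conj {M : Matrix (Fin n) (Fin n) ℝ} (hM : M.PosSemidef)
    (B : Matrix (Fin n) (Fin p) ℝ) : (Bᵀ * M * B).PosSemidef := by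
  simpa [Matrix.conjTranspose_eq_transpose_of_trivial] using hM.conjTranspose_mul_mul_same B

/-- With `M = BᵀB`, cyclicity of the trace turns `tr(MN)` into the trace of the positive
semidefinite matrix `BNBᵀ`. -/
lemma PosSemidef.trace_mul_nonneg {M N : Matrix (Fin n) (Fin n) ℝ}
    (hM : M.PosSemidef) (hN : N.PosSemidef) : 0 ≤ (M * N).trace := by
  obtain ⟨B, rfl⟩ := PosSemidef.exists_eq_transpose_mul_self hM
  have h := (PosSemidef.conj hN Bᵀ).trace_nonneg
  rwa [Matrix.transpose_transpose, Matrix.mul_assoc, Matrix.trace_mul_comm, Matrix.mul_assoc,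
    Matrix.trace_mul_comm] at h

/-- Two positive definite matrices `X`, `Y` separate `D` through `tr (X D Y Dᵀ)`. -/
lemma PosDef.eq_zero_of_trace_eq_zero {X Y D : Matrix (Fin n) (Fin n) ℝ}
    (hX : X.PosDef) (hY : Y.PosDef) (h : (X * (D * Y * Dᵀ)).trace = 0) : D = 0 := by
  obtain ⟨B, hB⟩ := PosSemidef.exists_eq_transpose_mul_self hX.posSemidef
  have hN : (D * Y * Dᵀ).PosSemidef := by
    simpa using PosSemidef.conj hY.posSemidef Dᵀ
  have h1 : (B * (D * Y * Dᵀ) * Bᵀ).PosSemidef := by simpa using PosSemidef.conj hN Bᵀ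
  have h2 : (B * (D * Y * Dᵀ) * Bᵀ).trace = 0 := by
    rw [Matrix.trace_mul_comm, ← Matrix.mul_assoc, ← hB, h]
  rw [h1.trace_eq_zero_iff] at h2
  have hu : IsUnit X := hX.isUnit
  have h3 : X * (D * Y * Dᵀ) * X = 0 := by
    have : X * (D * Y * Dᵀ) * X = Bᵀ * (B * (D * Y * Dᵀ) * Bᵀ) * B := by
      rw [hB]; noncomm_ring
    rw [this, h2]; simp
  have h4 : D * Y * Dᵀ = 0 := by
    rw [hu.mul_left_eq_zero, hu.mul_right_eq_zero] at h3
    exact h3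
  have h5 : ∀ v, Dᵀ *ᵥ v = 0 := by
    intro v
    by_contra hv
    have h6 := PosDef.quad_pos hY hv
    have h7 : (Dᵀ *ᵥ v) ⬝ᵥ (Y *ᵥ (Dᵀ *ᵥ v)) = v ⬝ᵥ ((D * Y * Dᵀ) *ᵥ v) := by
      rw [dotProduct_comm, quad_transpose, Matrix.mulVec_mulVec, Matrix.mulVec_mulVec,
        Matrix.mul_assoc]
    rw [h7, h4] at h6
    simp at h6
  have h8 : Dᵀ = 0 := by
    ext i j
    simpa using congrFun (h5 (Pi.single j 1)) i
  simpa using congrArg Matrix.transpose h8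

/-- A symmetric matrix is determined by its quadratic form. -/
lemma quad_polarization {M : Matrix (Fin n) (Fin n) ℝ} (hs : Mᵀ = M) (i j : Fin n) :
    M i j = ((Pi.single i 1 + Pi.single j 1) ⬝ᵥ (M *ᵥ (Pi.single i 1 + Pi.single j 1)) -
      (Pi.single i 1 - Pi.single j 1) ⬝ᵥ (M *ᵥ (Pi.single i 1 - Pi.single j 1))) / 4 := by
  have h : M j i = M i j := by conv_lhs => rw [← hs, Matrix.transpose_apply]
  simp [Matrix.mulVec_add, Matrix.mulVec_sub, h]
  ring

lemma eq_zero_of_quad {M : Matrix (Fin n) (Fin n) ℝ} (hs : Mᵀ = M)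
    (h : ∀ v, v ⬝ᵥ (M *ᵥ v) = 0) : M = 0 := by
  ext i j
  rw [quad_polarization hs, h, h]
  simp

lemma norm2_sq (v : Fin n → ℝ) : norm2 v ^ 2 = v ⬝ᵥ v := by
  rw [norm2, EuclideanSpace.norm_sq_eq]
  simp [dotProduct, pow_two]

lemma norm2_nonneg (v : Fin n → ℝ) : 0 ≤ norm2 v := norm_nonneg _

lemma minEig_mul_le_quad {M : Matrix (Fin n) (Fin n) ℝ} (hM : M.IsHermitian) (v : Fin n → ℝ) :
    minEig M * norm2 v ^ 2 ≤ v ⬝ᵥ (M *ᵥ v) := by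
  have h : (M - minEig M • (1 : Matrix (Fin n) (Fin n) ℝ)).PosSemidef := by
    rw [Matrix.posSemidef_iff_isHermitian_and_spectrum_nonneg]
    constructor
    · exact hM.sub (by simp [Matrix.IsHermitian])
    · intro a ha
      rw [← Algebra.algebraMap_eq_smul_one, sub_eq_add_neg, ← map_neg, add_comm,
        ← spectrum.vadd_eq, Set.mem_vadd_set] at ha
      obtain ⟨b, hb, rfl⟩ := ha
      have := csInf_le M.finite_real_spectrum.bddBelow hb
      simp [minEig] at this ⊢
      linarith
  have h2 := PosSemidef.quad_nonneg h v
  rw [Matrix.sub_mulVec, dotProduct_sub, Matrix.smul_mulVec, Matrix.one_mulVec,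
    dotProduct_smul, smul_eq_mul, ← norm2_sq] at h2
  linarith

lemma quad_le_maxEig_mul {M : Matrix (Fin n) (Fin n) ℝ} (hM : M.IsHermitian) (v : Fin n → ℝ) :
    v ⬝ᵥ (M *ᵥ v) ≤ maxEig M * norm2 v ^ 2 := by
  have h : (maxEig M • (1 : Matrix (Fin n) (Fin n) ℝ) - M).PosSemidef := by
    rw [Matrix.posSemidef_iff_isHermitian_and_spectrum_nonneg]
    constructor
    · exact Matrix.IsHermitian.sub (by simp [Matrix.IsHermitian]) hM
    · intro a ha
      rw [← Algebra.algebraMap_eq_smul_one, ← spectrum.singleton_sub_eq] at ha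
      obtain ⟨c, hc, b, hb, rfl⟩ := ha
      rw [Set.mem_singleton_iff] at hc
      have := le_csSup M.finite_real_spectrum.bddAbove hb
      simp [maxEig] at this hc ⊢
      linarith
  have h2 := PosSemidef.quad_nonneg h v
  rw [Matrix.sub_mulVec, dotProduct_sub, Matrix.smul_mulVec, Matrix.one_mulVec,
    dotProduct_smul, smul_eq_mul, ← norm2_sq] at h2
  linarith

/-- Size zero is included: the supremum of the empty spectrum is `0` by convention. -/
lemma maxEig_nonneg {M : Matrix (Fin n) (Fin n) ℝ} (hM : M.PosSemidef) : 0 ≤ maxEig M :=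
  Real.sSup_nonneg fun _ ha =>
    (Matrix.posSemidef_iff_isHermitian_and_spectrum_nonneg.1 hM).2 ha

/-- Size zero must be excluded, because the infimum of the empty spectrum is `0`. -/
lemma minEig_pos [NeZero n] {M : Matrix (Fin n) (Fin n) ℝ} (hM : M.PosDef) : 0 < minEig M := by
  have hr := hM.isHermitian.spectrum_real_eq_range_eigenvalues
  have hne : (spectrum ℝ M).Nonempty := hr ▸ Set.range_nonempty _
  have hmem : minEig M ∈ spectrum ℝ M := hne.csInf_mem M.finite_real_spectrum
  rw [hr] at hmem
  obtain ⟨i, hi⟩ := hmem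
  exact hi ▸ hM.eigenvalues_pos i

lemma abs_apply_le_norm2 (v : Fin n → ℝ) (i : Fin n) : |v i| ≤ norm2 v := by
  simpa [norm2] using PiLp.norm_apply_le (WithLp.toLp 2 v) i

/-- The entrywise distance suffices for perturbing quadratic forms, so continuity of eigenvalues is
never needed. -/
lemma abs_quad_sub_le (M N : Matrix (Fin n) (Fin n) ℝ) (v : Fin n → ℝ) :
    |v ⬝ᵥ (M *ᵥ v) - v ⬝ᵥ (N *ᵥ v)| ≤ (∑ i, ∑ j, |M i j - N i j|) * norm2 v ^ 2 := by
  have h : v ⬝ᵥ (M *ᵥ v) - v ⬝ᵥ (N *ᵥ v) = ∑ i, ∑ j, (M i j - N i j) * (v i * v j) := by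
    rw [← dotProduct_sub, ← Matrix.sub_mulVec]
    simp only [dotProduct, Matrix.mulVec, Finset.mul_sum, Matrix.sub_apply]
    exact Finset.sum_congr rfl fun i _ => Finset.sum_congr rfl fun j _ => by ring
  rw [h, Finset.sum_mul]
  refine (Finset.abs_sum_le_sum_abs _ _).trans (Finset.sum_le_sum fun i _ => ?_)
  rw [Finset.sum_mul]
  refine (Finset.abs_sum_le_sum_abs _ _).trans (Finset.sum_le_sum fun j _ => ?_)
  rw [abs_mul, abs_mul, pow_two]
  exact mul_le_mul_of_nonneg_left (mul_le_mul (abs_apply_le_norm2 v i) (abs_apply_le_norm2 v j)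
    (abs_nonneg _) (norm2_nonneg v)) (abs_nonneg _)

end LinearAlgebra

/-! ### Convergence of the Riccati flow and uniqueness of its equilibrium. -/

section Riccati

open scoped Matrix.Norms.Operator

variable {n p m : ℕ}

/-- The right-hand side of the Riccati equation. -/
def riccatiField (A G Q P : Matrix (Fin n) (Fin n) ℝ) : Matrix (Fin n) (Fin n) ℝ :=
  A * P + P * Aᵀ + Q - P * G * P

lemma riccatiField_transpose {A G Q P : Matrix (Fin n) (Fin n) ℝ} (hG : Gᵀ = G) (hQ : Qᵀ = Q)
    (hP : Pᵀ = P) : (riccatiField A G Q P)ᵀ = riccatiField A G Q P := by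
  simp only [riccatiField, Matrix.transpose_sub, Matrix.transpose_add, Matrix.transpose_mul,
    Matrix.transpose_transpose, hG, hQ, hP]
  noncomm_ring

/-- Cauchy-Schwarz for the inner product `tr (X Z X W)`, against `W = P v vᵀ P`. -/
lemma abs_quad_le_sqrt_trace_mul {P Z : Matrix (Fin n) (Fin n) ℝ} (hP : P.PosDef) (hZ : Zᵀ = Z)
    (v : Fin n → ℝ) :
    |v ⬝ᵥ (Z *ᵥ v)| ≤ √((P⁻¹ * Z * (P⁻¹ * Z)).trace) * (v ⬝ᵥ (P *ᵥ v)) := by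
  set X := P⁻¹ with hX
  have hPX : P * X = 1 := P.mul_nonsing_inv ((Matrix.isUnit_iff_isUnit_det _).1 hP.isUnit)
  have hXP : X * P = 1 := P.nonsing_inv_mul ((Matrix.isUnit_iff_isUnit_det _).1 hP.isUnit)
  have hXpd : X.PosSemidef := hP.posSemidef.inv
  have hPs : Pᵀ = P := isHermitian_iff_transpose.1 hP.isHermitian
  rcases eq_or_ne v 0 with rfl | hv
  · simp
  have hh := PosDef.quad_pos hP hv
  set h := v ⬝ᵥ (P *ᵥ v) with hh'
  set z := v ⬝ᵥ (Z *ᵥ v) with hz'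
  set O := Matrix.vecMulVec v v with hO
  have hOs : Oᵀ = O := by rw [hO, Matrix.transpose_vecMulVec]
  have trO : ∀ M : Matrix (Fin n) (Fin n) ℝ, (M * O).trace = v ⬝ᵥ (M *ᵥ v) := by
    intro M
    rw [hO, Matrix.mul_vecMulVec, Matrix.trace_vecMulVec, dotProduct_comm]
  have OMO : ∀ M : Matrix (Fin n) (Fin n) ℝ, O * M * O = (v ⬝ᵥ (M *ᵥ v)) • O := by
    intro M
    rw [Matrix.mul_assoc, hO, Matrix.mul_vecMulVec, Matrix.vecMulVec_mul_vecMulVec,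
      Matrix.vecMulVec_smul]
  -- Nonnegativity of `tr(XYXY)` along the line `Y = Z + l·POP`, where `O = vvᵀ`: the usual
  -- discriminant proof of Cauchy-Schwarz.
  have key : ∀ l : ℝ, 0 ≤ (X * Z * (X * Z)).trace + 2 * l * z + l ^ 2 * h ^ 2 := by
    intro l
    set Y := Z + l • (P * O * P) with hY
    have hYs : Yᵀ = Y := by
      simp only [hY, Matrix.transpose_add, Matrix.transpose_smul, Matrix.transpose_mul, hPs, hOs,
        hZ, Matrix.mul_assoc]
    have h1 := PosSemidef.trace_mul_nonneg hXpd (PosSemidef.conj hXpd Y)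
    have h2 : X * (Yᵀ * X * Y) = X * Z * (X * Z) + l • (O * P * X * Z) + l • (X * Z * O * P)
        + l ^ 2 • (O * P * O * P) := by
      have e1 : X * Y = X * Z + l • (O * P) := by
        rw [hY, mul_add, mul_smul_comm, ← mul_assoc, ← mul_assoc, hXP, one_mul]
      rw [hYs, ← mul_assoc, ← mul_assoc, mul_assoc (X * Y), e1]
      simp only [mul_add, add_mul, smul_mul_assoc, mul_smul_comm, smul_smul, pow_two, mul_assoc,
        smul_add]
      abel
    rw [h2] at h1
    have t1 : (O * P * X * Z).trace = z := by
      rw [mul_assoc O P X, hPX, mul_one, Matrix.trace_mul_comm, trO]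
    have t2 : (X * Z * O * P).trace = z := by
      rw [Matrix.trace_mul_comm, ← mul_assoc, ← mul_assoc, hPX, one_mul, trO]
    have t3 : (O * P * O * P).trace = h ^ 2 := by
      rw [OMO, smul_mul_assoc, Matrix.trace_smul, Matrix.trace_mul_comm, trO, smul_eq_mul, pow_two]
    simp only [Matrix.trace_add, Matrix.trace_smul, t1, t2, t3, smul_eq_mul] at h1
    linarith
  -- The minimiser of the quadratic polynomial in `l`.
  have k := key (-z / h ^ 2)
  have hg : z ^ 2 ≤ (X * Z * (X * Z)).trace * h ^ 2 := by
    have : (X * Z * (X * Z)).trace + 2 * (-z / h ^ 2) * z + (-z / h ^ 2) ^ 2 * h ^ 2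
        = ((X * Z * (X * Z)).trace * h ^ 2 - z ^ 2) / h ^ 2 := by
      field_simp
      ring
    rw [this] at k
    have h2 : 0 < h ^ 2 := by positivity
    rw [le_div_iff₀ h2, zero_mul] at k
    linarith
  rw [← Real.sqrt_sq_eq_abs]
  calc √(z ^ 2) ≤ √((X * Z * (X * Z)).trace * h ^ 2) := Real.sqrt_le_sqrt hg
    _ = _ := by rw [Real.sqrt_mul' _ (sq_nonneg h), Real.sqrt_sq hh.le]

/-- The trace identity behind the decay of `tr (P⁻¹ Ṗ P⁻¹ Ṗ)` along the Riccati flow. -/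
lemma trace_riccati_identity {A G Q P X Z : Matrix (Fin n) (Fin n) ℝ} (hPX : P * X = 1)
    (hXP : X * P = 1) (hZ : Z = riccatiField A G Q P) :
    ((-(X * Z * X) * Z + X * (A * Z + Z * Aᵀ - (Z * G * P + P * G * Z))) * (X * Z)).trace =
      -((X * Q * X + G) * (Z * X * Z)).trace := by
  set B := X * Z with hB
  have hZB : Z = P * B := by rw [hB, ← mul_assoc, hPX, one_mul]
  have hBe : B = X * A * P + Aᵀ + X * Q - G * P := by
    rw [hB, hZ, riccatiField]
    have e1 : X * (P * Aᵀ) = Aᵀ := by rw [← mul_assoc, hXP, one_mul]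
    have e2 : X * (P * G * P) = G * P := by rw [← mul_assoc, ← mul_assoc, hXP, one_mul]
    rw [mul_sub, mul_add, mul_add, e1, e2, mul_assoc]
  have e3 : -(B * X) * Z + X * (A * Z + Z * Aᵀ - (Z * G * P + P * G * Z)) =
      -(B * B) + (X * A * P - G * P) * B + B * (Aᵀ - G * P) := by
    have f1 : X * (P * G * Z) = G * P * B := by
      rw [← mul_assoc, ← mul_assoc, hXP, one_mul, mul_assoc, ← hZB]
    have f2 : X * (A * Z) = X * A * P * B := by
      rw [mul_assoc (X * A), ← hZB, mul_assoc]
    have f3 : B * X * Z = B * B := by rw [mul_assoc, ← hB]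
    have f4 : X * (Z * Aᵀ) = B * Aᵀ := by rw [hB, mul_assoc]
    have f5 : X * (Z * G * P) = B * (G * P) := by rw [hB]; noncomm_ring
    rw [neg_mul, f3, mul_sub, mul_add, mul_add, f1, f2, f4, f5]
    noncomm_ring
  have e4 : (X * Q * X + G) * (Z * X * Z) = (X * Q + G * P) * (B * B) := by
    have : Z * X * Z = P * (B * B) := by
      rw [← mul_assoc, ← hZB, mul_assoc, ← hB]
    rw [this, add_mul, add_mul, ← mul_assoc, mul_assoc (X * Q) X P, hXP, mul_one, ← mul_assoc G]
  rw [e3, e4, add_mul, Matrix.trace_add, mul_assoc B, Matrix.trace_mul_comm B, ← Matrix.trace_add,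
    ← Matrix.trace_neg]
  congr 1
  -- Everything is now a coefficient times `B * B`. Substituting for `X * A * P` cancels `B` and
  -- `Aᵀ` and leaves the coefficient `-(X * Q + G * P)`.
  have e5 : X * A * P = B - Aᵀ - X * Q + G * P := by rw [hBe]; noncomm_ring
  rw [e5]
  noncomm_ring

lemma hasDerivWithinAt_matrix {P : ℝ → Matrix (Fin n) (Fin p) ℝ} {P' : Matrix (Fin n) (Fin p) ℝ}
    {s : Set ℝ} {t : ℝ} :
    HasDerivWithinAt P P' s t ↔ ∀ i j, HasDerivWithinAt (fun u => P u i j) (P' i j) s t := by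
  refine hasDerivWithinAt_pi.trans (forall_congr' fun i => ?_)
  exact hasDerivWithinAt_pi

lemma hasDerivWithinAt_matrix_inv {P : ℝ → Matrix (Fin n) (Fin n) ℝ}
    {P' : Matrix (Fin n) (Fin n) ℝ} {s : Set ℝ} {t : ℝ} (h : HasDerivWithinAt P P' s t)
    (hu : IsUnit (P t)) :
    HasDerivWithinAt (fun u => (P u)⁻¹) (-((P t)⁻¹ * P' * (P t)⁻¹)) s t := by
  obtain ⟨u, hu⟩ := hu
  have h1 := hasFDerivAt_ringInverse (𝕜 := ℝ) u
  rw [hu] at h1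
  have h2 := h1.comp_hasDerivWithinAt t h
  have e : (fun u => (P u)⁻¹) = Ring.inverse ∘ P :=
    funext fun u => Matrix.nonsing_inv_eq_ringInverse _
  rw [e]
  refine h2.congr_deriv ?_
  rw [Matrix.nonsing_inv_eq_ringInverse, ← hu]
  simp

lemma hasDerivWithinAt_trace {P : ℝ → Matrix (Fin n) (Fin n) ℝ}
    {P' : Matrix (Fin n) (Fin n) ℝ} {s : Set ℝ} {t : ℝ} (h : HasDerivWithinAt P P' s t) :
    HasDerivWithinAt (fun u => (P u).trace) P'.trace s t := by
  rw [hasDerivWithinAt_matrix] at h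
  exact HasDerivWithinAt.fun_sum fun i _ => h i i

lemma hasDerivWithinAt_quad {P : ℝ → Matrix (Fin n) (Fin n) ℝ}
    {P' : Matrix (Fin n) (Fin n) ℝ} {s : Set ℝ} {t : ℝ} (h : HasDerivWithinAt P P' s t)
    (v : Fin n → ℝ) :
    HasDerivWithinAt (fun u => v ⬝ᵥ (P u *ᵥ v)) (v ⬝ᵥ (P' *ᵥ v)) s t := by
  rw [hasDerivWithinAt_matrix] at h
  simp only [dotProduct, Matrix.mulVec]
  exact HasDerivWithinAt.fun_sum fun i _ => (HasDerivWithinAt.fun_sum fun j _ =>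
    (h i j).mul_const (v j)).const_mul (v i)

lemma antitoneOn_of_hasDerivWithinAt {D : Set ℝ} (hD : Convex ℝ D) (h0 : D ⊆ Set.Ici 0)
    {f f' : ℝ → ℝ} (hf : ∀ t ∈ D, HasDerivWithinAt f (f' t) (Set.Ici 0) t)
    (hf' : ∀ t ∈ D, f' t ≤ 0) : AntitoneOn f D :=
  antitoneOn_of_hasDerivWithinAt_nonpos hD
    (fun t ht => ((hf t ht).mono h0).continuousWithinAt)
    (fun t ht => (hf t (interior_subset ht)).mono (interior_subset.trans h0))
    (fun t ht => hf' t (interior_subset ht))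

/-- Positive definiteness is an open condition on symmetric matrices. -/
lemma eventually_posDef {ι : Type*} {F : Filter ι} {M : Matrix (Fin n) (Fin n) ℝ} (hM : M.PosDef)
    {f : ι → Matrix (Fin n) (Fin n) ℝ} (hf : Tendsto f F (𝓝 M)) :
    ∀ᶠ s in F, (f s)ᵀ = f s → (f s).PosDef := by
  rcases Nat.eq_zero_or_pos n with rfl | hn
  · exact .of_forall fun s hs => posDef_of_quad hs fun v hv => absurd (Subsingleton.elim v 0) hv
  have : NeZero n := ⟨hn.ne'⟩
  have hc := minEig_pos hM
  have hd : Tendsto (fun s => ∑ i, ∑ j, |f s i j - M i j|) F (𝓝 0) := by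
    have : Continuous fun N : Matrix (Fin n) (Fin n) ℝ => ∑ i, ∑ j, |N i j - M i j| := by fun_prop
    simpa using! (this.tendsto M).comp hf
  filter_upwards [hd.eventually_lt_const hc] with s hs hsym
  refine posDef_of_quad hsym fun v hv => ?_
  have h1 := minEig_mul_le_quad hM.isHermitian v
  have h2 := abs_le.1 (abs_quad_sub_le (f s) M v)
  have h3 : 0 < norm2 v ^ 2 := by
    have : norm2 v ≠ 0 := by
      rw [norm2, norm_ne_zero_iff]
      simpa using hv
    positivity
  nlinarith [h2.1, mul_lt_mul_of_pos_right hs h3]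

/-- The data of a Riccati flow which satisfies the matrix inequality
`P⁻¹ Q P⁻¹ + G ≥ α P⁻¹` wherever it is invertible. -/
structure RiccatiFlow (A G Q : Matrix (Fin n) (Fin n) ℝ) (α : ℝ)
    (P : ℝ → Matrix (Fin n) (Fin n) ℝ) : Prop where
  pos : 0 < α
  symG : Gᵀ = G
  symQ : Qᵀ = Q
  sym : ∀ t, 0 ≤ t → (P t)ᵀ = P t
  deriv : ∀ t, 0 ≤ t → HasDerivWithinAt P (riccatiField A G Q (P t)) (Set.Ici 0) t
  lmi : ∀ t, 0 ≤ t → ((P t)⁻¹ * Q * (P t)⁻¹ + G - α • (P t)⁻¹).PosSemidef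
  init : (P 0).PosDef

/-- The squared size of `Ṗ` in the metric `P⁻¹`. -/
noncomputable def speedSq (A G Q P : Matrix (Fin n) (Fin n) ℝ) : ℝ :=
  (P⁻¹ * riccatiField A G Q P * (P⁻¹ * riccatiField A G Q P)).trace

namespace RiccatiFlow

variable {A G Q : Matrix (Fin n) (Fin n) ℝ} {α : ℝ} {P : ℝ → Matrix (Fin n) (Fin n) ℝ}
  {D : Set ℝ}

/-- `Z = Ṗ` itself evolves by the linearised Riccati equation, which supplies the derivative of
`P⁻¹Z`; `trace_riccati_identity` then removes all terms in `A`. -/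
lemma hasDerivWithinAt_speedSq (h : RiccatiFlow A G Q α P) {t : ℝ} (ht : 0 ≤ t)
    (hpd : (P t).PosDef) :
    HasDerivWithinAt (fun s => speedSq A G Q (P s))
      (-2 * (((P t)⁻¹ * Q * (P t)⁻¹ + G) * (riccatiField A G Q (P t) * (P t)⁻¹ *
        riccatiField A G Q (P t))).trace) (Set.Ici 0) t := by
  set Z := riccatiField A G Q (P t) with hZ
  set X := (P t)⁻¹ with hX
  have hdP := h.deriv t ht
  have hu : IsUnit (P t) := hpd.isUnit
  have hPX : P t * X = 1 := (P t).mul_nonsing_inv ((Matrix.isUnit_iff_isUnit_det _).1 hu)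
  have hXP : X * P t = 1 := (P t).nonsing_inv_mul ((Matrix.isUnit_iff_isUnit_det _).1 hu)
  have hdX := hasDerivWithinAt_matrix_inv hdP hu
  have hdZ : HasDerivWithinAt (fun s => riccatiField A G Q (P s))
      (A * Z + Z * Aᵀ - (Z * G * P t + P t * G * Z)) (Set.Ici 0) t :=
    (((hdP.const_mul A).add (hdP.mul_const Aᵀ)).add_const Q).sub ((hdP.mul_const G).mul hdP)
  have hdB := hdX.mul hdZ
  have := hasDerivWithinAt_trace (hdB.mul hdB)
  refine this.congr_deriv ?_
  rw [Matrix.trace_add]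
  -- The two terms of the product rule for `tr(B²)` agree by cyclicity.
  conv_lhs =>
    enter [2]
    rw [Matrix.trace_mul_comm]
  have key := trace_riccati_identity (A := A) (G := G) (Q := Q) hPX hXP hZ
  simp only [Pi.mul_apply]
  rw [← hX, ← hZ, key]
  ring

/-- The matrix inequality, paired under the trace with `ZP⁻¹Z ≥ 0`, makes the derivative at most
`-2α` times the function. The time set `D` is left general because the estimate is needed on `[0,
τ)`, before positivity is known for all times, and later on `[0, ∞)`. -/
lemma speedSq_le (h : RiccatiFlow A G Q α P) (hD : Convex ℝ D) (h0 : D ⊆ Set.Ici 0)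
    (h0D : (0 : ℝ) ∈ D) (hpd : ∀ t ∈ D, (P t).PosDef) {t : ℝ} (ht : t ∈ D) :
    speedSq A G Q (P t) ≤ Real.exp (-2 * α * t) * speedSq A G Q (P 0) := by
  have hanti : AntitoneOn (fun s => Real.exp (2 * α * s) * speedSq A G Q (P s)) D := by
    refine antitoneOn_of_hasDerivWithinAt hD h0 (fun s hs =>
      (((hasDerivAt_id s).const_mul (2 * α)).exp.hasDerivWithinAt).mul
        (h.hasDerivWithinAt_speedSq (h0 hs) (hpd s hs))) ?_
    intro s hs
    have hZs := riccatiField_transpose (A := A) h.symG h.symQ (h.sym s (h0 hs))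
    have h1 := PosSemidef.trace_mul_nonneg (h.lmi s (h0 hs))
      (PosSemidef.conj (hpd s hs).posSemidef.inv (riccatiField A G Q (P s)))
    rw [hZs, sub_mul, Matrix.trace_sub, smul_mul_assoc, Matrix.trace_smul, smul_eq_mul] at h1
    have h2 : ((P s)⁻¹ * (riccatiField A G Q (P s) * (P s)⁻¹ * riccatiField A G Q (P s))).trace
        = speedSq A G Q (P s) := by
      rw [speedSq]; congr 1; simp only [mul_assoc]
    rw [h2] at h1
    have := (Real.exp_pos (2 * α * s)).le
    simp only [id, mul_one]
    nlinarith [mul_nonneg this h1]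
  have := hanti h0D ht (h0 ht)
  simp only [mul_zero, Real.exp_zero, one_mul] at this
  have h3 : Real.exp (-2 * α * t) * Real.exp (2 * α * t) = 1 := by
    rw [← Real.exp_add]; simp
  calc speedSq A G Q (P t) = Real.exp (-2 * α * t) *
        (Real.exp (2 * α * t) * speedSq A G Q (P t)) := by rw [← mul_assoc, h3, one_mul]
    _ ≤ _ := by gcongr

lemma abs_quad_le (h : RiccatiFlow A G Q α P) (hD : Convex ℝ D) (h0 : D ⊆ Set.Ici 0)
    (h0D : (0 : ℝ) ∈ D) (hpd : ∀ t ∈ D, (P t).PosDef) {t : ℝ} (ht : t ∈ D) (v : Fin n → ℝ) :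
    |v ⬝ᵥ (riccatiField A G Q (P t) *ᵥ v)| ≤
      √(speedSq A G Q (P 0)) * Real.exp (-α * t) * (v ⬝ᵥ (P t *ᵥ v)) := by
  refine (abs_quad_le_sqrt_trace_mul (hpd t ht)
    (riccatiField_transpose h.symG h.symQ (h.sym t (h0 ht))) v).trans ?_
  refine mul_le_mul_of_nonneg_right ?_ (PosSemidef.quad_nonneg (hpd t ht).posSemidef v)
  refine (Real.sqrt_le_sqrt (h.speedSq_le hD h0 h0D hpd ht)).trans_eq ?_
  rw [Real.sqrt_mul (Real.exp_pos _).le, mul_comm]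
  congr 1
  rw [← Real.exp_half]
  congr 1
  ring

/-- The exponent of the comparison factor for the quadratic forms of the flow. -/
noncomputable def slack (A G Q : Matrix (Fin n) (Fin n) ℝ) (α : ℝ)
    (P0 : Matrix (Fin n) (Fin n) ℝ) (t : ℝ) : ℝ :=
  √(speedSq A G Q P0) / α * Real.exp (-α * t)

lemma hasDerivAt_slack (hα : α ≠ 0) (P0 : Matrix (Fin n) (Fin n) ℝ) (t : ℝ) :
    HasDerivAt (slack A G Q α P0) (-(√(speedSq A G Q P0) * Real.exp (-α * t))) t := by
  have := (((hasDerivAt_id t).const_mul (-α)).exp).const_mul (√(speedSq A G Q P0) / α)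
  refine this.congr_deriv ?_
  field_simp
  simp

/-- `slack` is the integral of the bound on `|d/dt log(vᵀPv)|` from `t` to infinity, so adding it to
the logarithm absorbs any growth; subtracting it absorbs any decrease. -/
lemma antitoneOn_quad_mul_exp (h : RiccatiFlow A G Q α P) (hD : Convex ℝ D) (h0 : D ⊆ Set.Ici 0)
    (h0D : (0 : ℝ) ∈ D) (hpd : ∀ t ∈ D, (P t).PosDef) (v : Fin n → ℝ) :
    AntitoneOn (fun t => (v ⬝ᵥ (P t *ᵥ v)) * Real.exp (slack A G Q α (P 0) t)) D := by
  refine antitoneOn_of_hasDerivWithinAt hD h0 (fun t ht =>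
    (hasDerivWithinAt_quad (h.deriv t (h0 ht)) v).mul
      (hasDerivAt_slack h.pos.ne' (P 0) t).exp.hasDerivWithinAt) ?_
  intro t ht
  have h1 := (abs_le.1 (h.abs_quad_le hD h0 h0D hpd ht v)).2
  have := mul_le_mul_of_nonneg_right h1 (Real.exp_pos (slack A G Q α (P 0) t)).le
  linarith

lemma antitoneOn_neg_quad_mul_exp (h : RiccatiFlow A G Q α P) (hD : Convex ℝ D)
    (h0 : D ⊆ Set.Ici 0) (h0D : (0 : ℝ) ∈ D) (hpd : ∀ t ∈ D, (P t).PosDef) (v : Fin n → ℝ) :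
    AntitoneOn (fun t => -((v ⬝ᵥ (P t *ᵥ v)) * Real.exp (-slack A G Q α (P 0) t))) D := by
  refine antitoneOn_of_hasDerivWithinAt hD h0 (fun t ht =>
    ((hasDerivWithinAt_quad (h.deriv t (h0 ht)) v).mul
      (hasDerivAt_slack h.pos.ne' (P 0) t).neg.exp.hasDerivWithinAt).neg) ?_
  intro t ht
  have h1 := (abs_le.1 (h.abs_quad_le hD h0 h0D hpd ht v)).1
  have := mul_le_mul_of_nonneg_right h1 (Real.exp_pos (-slack A G Q α (P 0) t)).le
  simp only [Pi.neg_apply]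
  linarith

lemma slack_nonneg (hα : 0 < α) (P0 : Matrix (Fin n) (Fin n) ℝ) (t : ℝ) :
    0 ≤ slack A G Q α P0 t := by
  unfold slack; positivity

/-- The factor depends neither on `t` nor on `D`, so the bound survives passage to the end of the
interval and to infinity. -/
lemma quad_ge (h : RiccatiFlow A G Q α P) (hD : Convex ℝ D) (h0 : D ⊆ Set.Ici 0)
    (h0D : (0 : ℝ) ∈ D) (hpd : ∀ t ∈ D, (P t).PosDef) {t : ℝ} (ht : t ∈ D) (v : Fin n → ℝ) :
    Real.exp (-slack A G Q α (P 0) 0) * (v ⬝ᵥ (P 0 *ᵥ v)) ≤ v ⬝ᵥ (P t *ᵥ v) := by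
  have h1 := h.antitoneOn_neg_quad_mul_exp hD h0 h0D hpd v h0D ht (h0 ht)
  simp only [neg_le_neg_iff] at h1
  rw [mul_comm]
  refine h1.trans (mul_le_of_le_one_right (PosSemidef.quad_nonneg (hpd t ht).posSemidef v) ?_)
  rw [Real.exp_le_one_iff]
  linarith [slack_nonneg (A := A) (G := G) (Q := Q) h.pos (P 0) t]

lemma continuousOn_quad (h : RiccatiFlow A G Q α P) (v : Fin n → ℝ) :
    ContinuousOn (fun t => v ⬝ᵥ (P t *ᵥ v)) (Set.Ici 0) := fun t ht =>
  (hasDerivWithinAt_quad (h.deriv t ht) v).continuousWithinAt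

/-- Along such a flow positive definiteness is never lost. -/
lemma posDef (h : RiccatiFlow A G Q α P) {t : ℝ} (ht : 0 ≤ t) : (P t).PosDef := by
  by_contra hcon
  set N : Set ℝ := {s | 0 ≤ s ∧ ¬ (P s).PosDef} with hN
  have hNne : N.Nonempty := ⟨t, ht, hcon⟩
  have hNb : BddBelow N := ⟨0, fun s hs => hs.1⟩
  set τ := sInf N with hτ
  have hτ0 : 0 ≤ τ := le_csInf hNne fun s hs => hs.1
  have hbefore : ∀ s, 0 ≤ s → s < τ → (P s).PosDef := by
    intro s hs hsτ
    by_contra hc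
    exact absurd (csInf_le hNb (show s ∈ N from ⟨hs, hc⟩)) (not_le.2 hsτ)
  set κ := Real.exp (-slack A G Q α (P 0) 0) with hκ
  have hκ0 : 0 < κ := Real.exp_pos _
  -- At the first possible exit time `τ` the lower bound persists by left continuity, so `P τ` is
  -- still positive definite; openness then keeps `P` positive definite just after `τ`, against the
  -- choice of `τ` as an infimum.
  have hτq : ∀ v, κ * (v ⬝ᵥ (P 0 *ᵥ v)) ≤ v ⬝ᵥ (P τ *ᵥ v) := by
    intro v
    rcases hτ0.eq_or_lt with h0 | hpos
    · rw [← h0]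
      refine mul_le_of_le_one_left (PosSemidef.quad_nonneg h.init.posSemidef v) ?_
      rw [hκ, Real.exp_le_one_iff]
      linarith [slack_nonneg (A := A) (G := G) (Q := Q) h.pos (P 0) 0]
    · have hc : ContinuousWithinAt (fun t => v ⬝ᵥ (P t *ᵥ v)) (Set.Ico 0 τ) τ :=
        (h.continuousOn_quad v τ hτ0).mono fun s hs => hs.1
      have hne : (𝓝[Set.Ico 0 τ] τ).NeBot := by
        rw [← mem_closure_iff_nhdsWithin_neBot, closure_Ico hpos.ne]
        exact ⟨hτ0, le_rfl⟩
      refine ge_of_tendsto hc ?_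
      filter_upwards [self_mem_nhdsWithin] with s hs
      exact h.quad_ge (convex_Ico 0 τ) (fun s hs => hs.1) ⟨le_rfl, hpos⟩
        (fun s hs => hbefore s hs.1 hs.2) hs v
  have hτpd : (P τ).PosDef := posDef_of_quad (h.sym τ hτ0) fun v hv =>
    (mul_pos hκ0 (PosDef.quad_pos h.init hv)).trans_le (hτq v)
  have hev : ∀ᶠ s in 𝓝[Set.Ici 0] τ, (P s).PosDef := by
    have hcP : Tendsto P (𝓝[Set.Ici 0] τ) (𝓝 (P τ)) := (h.deriv τ hτ0).continuousWithinAt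
    filter_upwards [eventually_posDef hτpd hcP, self_mem_nhdsWithin] with s hs hs0
    exact hs (h.sym s hs0)
  rw [eventually_nhdsWithin_iff, Metric.eventually_nhds_iff] at hev
  obtain ⟨δ, hδ, hev⟩ := hev
  obtain ⟨s, hsN, hs⟩ := exists_lt_of_csInf_lt hNne (show sInf N < τ + δ by linarith)
  have hτs : τ ≤ s := csInf_le hNb hsN
  exact hsN.2 (hev (by rw [Real.dist_eq, abs_of_nonneg (by linarith)]; linarith) hsN.1)

lemma exists_tendsto_quad (h : RiccatiFlow A G Q α P) (v : Fin n → ℝ) :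
    ∃ l, Tendsto (fun t => v ⬝ᵥ (P t *ᵥ v)) atTop (𝓝 l) := by
  have hpd : ∀ t ∈ Set.Ici (0 : ℝ), (P t).PosDef := fun t ht => h.posDef ht
  have hanti := h.antitoneOn_quad_mul_exp (convex_Ici 0) subset_rfl Set.self_mem_Ici hpd v
  set f : ℝ → ℝ := fun t => (v ⬝ᵥ (P t *ᵥ v)) * Real.exp (slack A G Q α (P 0) t) with hf
  -- Freezing the function at its value at `0` for negative times makes it monotone on all of `ℝ`.
  have hanti' : Antitone fun t => f (max t 0) := fun s t hst =>
    hanti (Set.mem_Ici.2 (le_max_right _ _)) (Set.mem_Ici.2 (le_max_right _ _))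
      (max_le_max_right 0 hst)
  have hb : BddBelow (Set.range fun t => f (max t 0)) := by
    refine ⟨0, ?_⟩
    rintro _ ⟨t, rfl⟩
    exact mul_nonneg (PosSemidef.quad_nonneg (hpd _ (le_max_right t 0)).posSemidef v)
      (Real.exp_pos _).le
  have hl := tendsto_atTop_ciInf hanti' hb
  have hs : Tendsto (slack A G Q α (P 0)) atTop (𝓝 0) := by
    have : Tendsto (fun t : ℝ => Real.exp (-α * t)) atTop (𝓝 0) :=
      Real.tendsto_exp_atBot.comp (tendsto_id.const_mul_atTop_of_neg (by linarith [h.pos]))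
    have h0 := this.const_mul (√(speedSq A G Q (P 0)) / α)
    rw [mul_zero] at h0
    exact h0
  have hs' := (Real.continuous_exp.tendsto _).comp hs.neg
  refine ⟨_, (hl.mul hs').congr' ?_⟩
  filter_upwards [eventually_ge_atTop 0] with t ht
  simp only [hf, max_eq_left ht, Function.comp_apply, mul_assoc, ← Real.exp_add]
  simp

/-- The flow converges to a positive definite solution of the algebraic Riccati equation. -/
lemma exists_tendsto (h : RiccatiFlow A G Q α P) :
    ∃ Pinf : Matrix (Fin n) (Fin n) ℝ, Tendsto P atTop (𝓝 Pinf) ∧ Pinf.PosDef ∧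
      riccatiField A G Q Pinf = 0 := by
  have hpd : ∀ t ∈ Set.Ici (0 : ℝ), (P t).PosDef := fun t ht => h.posDef ht
  choose l hl using h.exists_tendsto_quad
  -- The limits of the quadratic forms determine the limit matrix by polarization.
  set Pinf : Matrix (Fin n) (Fin n) ℝ := Matrix.of fun i j =>
    (l (Pi.single i 1 + Pi.single j 1) - l (Pi.single i 1 - Pi.single j 1)) / 4 with hPinf
  have hlim : Tendsto P atTop (𝓝 Pinf) := by
    refine tendsto_pi_nhds.2 fun i => tendsto_pi_nhds.2 fun j => ?_
    refine (((hl (Pi.single i 1 + Pi.single j 1)).sub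
      (hl (Pi.single i 1 - Pi.single j 1))).div_const 4).congr' ?_
    filter_upwards [eventually_ge_atTop 0] with t ht
    rw [← quad_polarization (h.sym t ht)]
  have hquad : ∀ v, Tendsto (fun t => v ⬝ᵥ (P t *ᵥ v)) atTop (𝓝 (v ⬝ᵥ (Pinf *ᵥ v))) := by
    intro v
    have hc : Continuous fun M : Matrix (Fin n) (Fin n) ℝ => v ⬝ᵥ (M *ᵥ v) := by fun_prop
    exact (hc.tendsto Pinf).comp hlim
  have hsym : Pinfᵀ = Pinf := by
    have hc : Continuous fun M : Matrix (Fin n) (Fin n) ℝ => Mᵀ := by fun_prop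
    refine tendsto_nhds_unique ((hc.tendsto Pinf).comp hlim) (hlim.congr' ?_)
    filter_upwards [eventually_ge_atTop 0] with t ht
    exact (h.sym t ht).symm
  refine ⟨Pinf, hlim, posDef_of_quad hsym fun v hv => ?_, ?_⟩
  · refine (mul_pos (Real.exp_pos (-slack A G Q α (P 0) 0))
      (PosDef.quad_pos h.init hv)).trans_le (ge_of_tendsto (hquad v) ?_)
    filter_upwards [eventually_ge_atTop 0] with t ht
    exact h.quad_ge (convex_Ici 0) subset_rfl Set.self_mem_Ici hpd ht v
  · refine eq_zero_of_quad (riccatiField_transpose h.symG h.symQ hsym) fun v => ?_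
    have hc : Continuous fun M : Matrix (Fin n) (Fin n) ℝ =>
        v ⬝ᵥ (riccatiField A G Q M *ᵥ v) := by
      unfold riccatiField; fun_prop
    refine tendsto_nhds_unique ((hc.tendsto Pinf).comp hlim) ?_
    have he : Tendsto (fun t : ℝ => Real.exp (-α * t)) atTop (𝓝 0) :=
      Real.tendsto_exp_atBot.comp (tendsto_id.const_mul_atTop_of_neg (by linarith [h.pos]))
    have h0 := ((he.const_mul (√(speedSq A G Q (P 0)))).mul (hquad v))
    rw [mul_zero, zero_mul] at h0
    refine squeeze_zero_norm' ?_ h0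
    filter_upwards [eventually_ge_atTop 0] with t ht
    exact h.abs_quad_le (convex_Ici 0) subset_rfl Set.self_mem_Ici hpd ht v

end RiccatiFlow

/-- A positive definite solution of the algebraic Riccati equation that satisfies
`P⁻¹ Q P⁻¹ + G ≥ α P⁻¹` is the only positive definite solution. -/
lemma riccati_unique {A G Q P P' : Matrix (Fin n) (Fin n) ℝ} {α : ℝ} (hα : 0 < α)
    (hG : G.PosSemidef) (hQ : Q.PosSemidef) (hP : P.PosDef) (hP' : P'.PosDef)
    (hlmi : (P⁻¹ * Q * P⁻¹ + G - α • P⁻¹).PosSemidef)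
    (h : riccatiField A G Q P = 0) (h' : riccatiField A G Q P' = 0) : P' = P := by
  set X := P⁻¹ with hX
  set Y := P'⁻¹ with hY
  have hPX : P * X = 1 := P.mul_nonsing_inv ((Matrix.isUnit_iff_isUnit_det _).1 hP.isUnit)
  have hXP : X * P = 1 := P.nonsing_inv_mul ((Matrix.isUnit_iff_isUnit_det _).1 hP.isUnit)
  have hPY : P' * Y = 1 := P'.mul_nonsing_inv ((Matrix.isUnit_iff_isUnit_det _).1 hP'.isUnit)
  have hYP : Y * P' = 1 := P'.nonsing_inv_mul ((Matrix.isUnit_iff_isUnit_det _).1 hP'.isUnit)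
  have hXpd : X.PosDef := hP.inv
  have hYpd : Y.PosDef := hP'.inv
  have hPs : Pᵀ = P := isHermitian_iff_transpose.1 hP.isHermitian
  have hPs' : P'ᵀ = P' := isHermitian_iff_transpose.1 hP'.isHermitian
  have hXs : Xᵀ = X := isHermitian_iff_transpose.1 hXpd.isHermitian
  have hYs : Yᵀ = Y := isHermitian_iff_transpose.1 hYpd.isHermitian
  set Δ := P' - P with hΔ
  have hΔs : Δᵀ = Δ := by rw [hΔ, Matrix.transpose_sub, hPs, hPs']
  have eX : X * A + Aᵀ * X = G - X * Q * X := by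
    have : X * riccatiField A G Q P * X = X * A * (P * X) + (X * P) * (Aᵀ * X) + X * Q * X
        - (X * P) * G * (P * X) := by unfold riccatiField; noncomm_ring
    rw [h, hPX, hXP] at this
    simp only [mul_zero, zero_mul, mul_one, one_mul] at this
    rw [eq_sub_iff_add_eq, ← sub_eq_zero, ← this]
  have eY : Y * A + Aᵀ * Y = G - Y * Q * Y := by
    have : Y * riccatiField A G Q P' * Y = Y * A * (P' * Y) + (Y * P') * (Aᵀ * Y) + Y * Q * Y
        - (Y * P') * G * (P' * Y) := by unfold riccatiField; noncomm_ring
    rw [h', hPY, hYP] at this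
    simp only [mul_zero, zero_mul, mul_one, one_mul] at this
    rw [eq_sub_iff_add_eq, ← sub_eq_zero, ← this]
  have eΔ : A * Δ + Δ * Aᵀ = P' * G * Δ + Δ * G * P := by
    have : riccatiField A G Q P' - riccatiField A G Q P =
        A * Δ + Δ * Aᵀ - (P' * G * Δ + Δ * G * P) := by
      rw [hΔ]; unfold riccatiField; noncomm_ring
    rw [h, h', sub_zero] at this
    rw [← sub_eq_zero, ← this]
  set N := X * Q * X + G with hN
  set N' := Y * Q * Y + G with hN'
  -- The trace of `Y(AΔ + ΔAᵀ)XΔ` is doubled by transposition. It is evaluated once by the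
  -- difference of the two Riccati equations, and once by moving `A` onto `X` and `Y` and using the
  -- equations for the inverses.
  have key : (Y * (Δ * N * Δ)).trace = - (N' * (Δ * X * Δ)).trace := by
    have h1 : (Y * ((A * Δ + Δ * Aᵀ) * X * Δ)).trace =
        (Y * ((P' * G * Δ + Δ * G * P) * X * Δ)).trace := by rw [eΔ]
    have h2 : (Y * (Δ * X * (A * Δ + Δ * Aᵀ))).trace =
        (Y * ((A * Δ + Δ * Aᵀ) * X * Δ)).trace := by
      rw [← Matrix.trace_transpose]
      simp only [Matrix.transpose_mul, Matrix.transpose_add, Matrix.transpose_transpose, hΔs, hXs,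
        hYs]
      rw [Matrix.trace_mul_comm]
      congr 1
      noncomm_ring
    have h3 : (Y * ((P' * G * Δ + Δ * G * P) * X * Δ)).trace =
        (G * (Δ * X * Δ)).trace + (Y * (Δ * G * Δ)).trace := by
      rw [← Matrix.trace_add]
      congr 1
      have : Y * ((P' * G * Δ + Δ * G * P) * X * Δ) =
          (Y * P') * (G * (Δ * X * Δ)) + Y * (Δ * G * (P * X) * Δ) := by noncomm_ring
      rw [this, hYP, hPX, one_mul, mul_one]
    have h4 : (Y * ((A * Δ + Δ * Aᵀ) * X * Δ)).trace + (Y * (Δ * X * (A * Δ + Δ * Aᵀ))).trace =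
        ((Y * A + Aᵀ * Y) * (Δ * X * Δ)).trace + (Y * (Δ * (X * A + Aᵀ * X) * Δ)).trace := by
      have e1 : (Aᵀ * Y * (Δ * X * Δ)).trace = (Y * (Δ * X * Δ * Aᵀ)).trace := by
        rw [mul_assoc, Matrix.trace_mul_comm, mul_assoc]
      rw [add_mul (Y * A), Matrix.trace_add, e1, ← Matrix.trace_add, ← Matrix.trace_add,
        ← Matrix.trace_add]
      congr 1
      noncomm_ring
    rw [h2, h1, h3, eX, eY] at h4
    have h5 : (Y * (Δ * N * Δ)).trace + (N' * (Δ * X * Δ)).trace =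
        2 * ((G * (Δ * X * Δ)).trace + (Y * (Δ * G * Δ)).trace) -
        (((G - Y * Q * Y) * (Δ * X * Δ)).trace + (Y * (Δ * (G - X * Q * X) * Δ)).trace) := by
      simp only [hN, hN', mul_add, add_mul, mul_sub, sub_mul, Matrix.trace_add, Matrix.trace_sub]
      ring
    linarith
  have hN's : 0 ≤ (N' * (Δ * X * Δ)).trace := by
    refine PosSemidef.trace_mul_nonneg (Matrix.PosSemidef.add ?_ hG) ?_
    · simpa only [hYs] using PosSemidef.conj hQ Y
    · simpa only [hΔs] using PosSemidef.conj hXpd.posSemidef Δ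
  have h1 : 0 ≤ (Y * (Δ * (N - α • X) * Δ)).trace := by
    refine PosSemidef.trace_mul_nonneg hYpd.posSemidef ?_
    simpa only [hΔs] using PosSemidef.conj hlmi Δ
  have h2 : (Y * (Δ * (N - α • X) * Δ)).trace =
      (Y * (Δ * N * Δ)).trace - α * (Y * (Δ * X * Δ)).trace := by
    rw [mul_sub Δ N, sub_mul (Δ * N), mul_sub Y, Matrix.trace_sub, mul_smul_comm, smul_mul_assoc,
      mul_smul_comm, Matrix.trace_smul, smul_eq_mul]
  have h3 : 0 ≤ (Y * (Δ * X * Δ)).trace := by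
    refine PosSemidef.trace_mul_nonneg hYpd.posSemidef ?_
    simpa only [hΔs] using PosSemidef.conj hXpd.posSemidef Δ
  -- `key` and `hN's` make `tr(YΔNΔ)` nonpositive, while the matrix inequality makes it at least `α
  -- tr(YΔXΔ) ≥ 0`.
  have h4 : (Y * (Δ * X * Δ)).trace = 0 := by nlinarith
  have := PosDef.eq_zero_of_trace_eq_zero (D := Δ) hYpd hXpd (by rw [hΔs, h4])
  rwa [hΔ, sub_eq_zero] at this


end Riccati

/-! ### Comparison principles for Carathéodory solutions. -/

section AbsolutelyContinuous

lemma absolutelyContinuous_sum {ι : Type*} (s : Finset ι) {f : ι → ℝ → ℝ} {a b : ℝ}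
    (h : ∀ i ∈ s, AbsolutelyContinuousOnInterval (f i) a b) :
    AbsolutelyContinuousOnInterval (fun t => ∑ i ∈ s, f i t) a b := by
  classical
  induction s using Finset.induction_on with
  | empty =>
    simp only [Finset.sum_empty]
    exact (LipschitzWith.const (0 : ℝ)).lipschitzOnWith.absolutelyContinuousOnInterval
  | insert i s hi ih =>
    simp only [Finset.sum_insert hi]
    exact (h i (Finset.mem_insert_self _ _)).fun_add
      (ih fun j hj => h j (Finset.mem_insert_of_mem hj))

lemma absolutelyContinuous_of_hasDerivWithinAt {f f' : ℝ → ℝ}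
    (hf : ∀ t, 0 ≤ t → HasDerivWithinAt f (f' t) (Set.Ici 0) t)
    (hf' : ContinuousOn f' (Set.Ici 0)) {T : ℝ} (hT : 0 ≤ T) :
    AbsolutelyContinuousOnInterval f 0 T := by
  have hsub : Set.uIcc 0 T ⊆ Set.Ici 0 := by
    rw [Set.uIcc_of_le hT]; exact Set.Icc_subset_Ici_self
  obtain ⟨K, hK⟩ := isCompact_uIcc.exists_bound_of_continuousOn (hf'.mono hsub)
  refine LipschitzOnWith.absolutelyContinuousOnInterval (K := K.toNNReal) ?_
  refine Convex.lipschitzOnWith_of_nnnorm_hasDerivWithin_le (convex_uIcc 0 T) (f' := f')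
    (fun t ht => (hf t (hsub ht)).mono hsub) fun t ht => ?_
  rw [← NNReal.coe_le_coe, coe_nnnorm]
  exact (hK t ht).trans (Real.le_coe_toNNReal K)

lemma absolutelyContinuous_exp (c : ℝ) {T : ℝ} (hT : 0 ≤ T) :
    AbsolutelyContinuousOnInterval (fun t => Real.exp (c * t)) 0 T :=
  absolutelyContinuous_of_hasDerivWithinAt (f' := fun t => Real.exp (c * t) * (c * 1))
    (fun t _ => ((hasDerivAt_id t).const_mul c).exp.hasDerivWithinAt) (by fun_prop) hT

/-- The fundamental theorem of calculus for absolutely continuous functions; an almost everywhere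
derivative alone would not suffice. -/
lemma Solves.mono_of_nonneg {f g : ℝ → ℝ} (h : Solves f g)
    (hg : ∀ᵐ t : ℝ, 0 ≤ t → 0 ≤ g t) {T : ℝ} (hT : 0 ≤ T) : f 0 ≤ f T := by
  have h1 := (h.1 T hT).integral_deriv_eq_sub
  have h2 : 0 ≤ ∫ t in (0 : ℝ)..T, deriv f t := by
    refine intervalIntegral.integral_nonneg_of_ae_restrict hT ?_
    refine (ae_restrict_iff' measurableSet_Icc).2 ?_
    filter_upwards [h.2, hg] with t ht hgt ht0
    rw [(ht ht0.1).deriv]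
    exact hgt ht0.1
  linarith

lemma Solves.exp_mul {f g : ℝ → ℝ} (h : Solves f g) (c : ℝ) :
    Solves (fun t => Real.exp (c * t) * f t) (fun t => Real.exp (c * t) * (c * f t + g t)) := by
  refine ⟨fun T hT => (absolutelyContinuous_exp c hT).fun_mul (h.1 T hT), ?_⟩
  filter_upwards [h.2] with t ht ht0
  refine (((hasDerivAt_id t).const_mul c).exp.fun_mul (ht ht0)).congr_deriv ?_
  simp only [id, mul_one]
  ring

/-- Multiplying by the integrating factor `e^{-ct}` gives a nondecreasing function. -/
lemma Solves.pos {f g : ℝ → ℝ} (h : Solves f g) (c : ℝ) (hg : ∀ t, 0 ≤ t → c * f t ≤ g t)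
    (h0 : 0 < f 0) {T : ℝ} (hT : 0 ≤ T) : 0 < f T := by
  have h1 := (h.exp_mul (-c)).mono_of_nonneg (.of_forall fun t ht =>
    mul_nonneg (Real.exp_pos _).le (by linarith [hg t ht])) hT
  simp only [mul_zero, Real.exp_zero, one_mul] at h1
  exact pos_of_mul_pos_right (h0.trans_le h1) (Real.exp_pos _).le

/-- Grönwall's inequality for absolutely continuous functions. -/
lemma Solves.gronwall {V g : ℝ → ℝ} (h : Solves V g) {α κ : ℝ} (hα : 0 < α)
    (hg : ∀ t, 0 < t → g t ≤ -α * V t + κ) {T : ℝ} (hT : 0 ≤ T) :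
    V T ≤ Real.exp (-α * T) * V 0 + 1 / α * (1 - Real.exp (-α * T)) * κ := by
  -- The gap to the equilibrium `κ/α` of the comparison equation; multiplied by `e^{αt}` it is
  -- nondecreasing.
  have hF : Solves (fun t => κ / α - V t) (fun t => -g t) := by
    refine ⟨fun T hT => ?_, ?_⟩
    · exact (LipschitzWith.const (κ / α)).lipschitzOnWith.absolutelyContinuousOnInterval.fun_sub
        (h.1 T hT)
    · filter_upwards [h.2] with t ht ht0
      exact (ht ht0).const_sub _
  have h1 := (hF.exp_mul α).mono_of_nonneg (by
    filter_upwards [Measure.ae_ne volume 0] with t hne ht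
    refine mul_nonneg (Real.exp_pos _).le ?_
    have := hg t (lt_of_le_of_ne ht hne.symm)
    have e : α * (κ / α - V t) = κ - α * V t := by field_simp
    rw [e]
    linarith) hT
  simp only [mul_zero, Real.exp_zero, one_mul] at h1
  have h2 : Real.exp (-α * T) * Real.exp (α * T) = 1 := by
    rw [← Real.exp_add]; simp
  have h3 := mul_le_mul_of_nonneg_left h1 (Real.exp_pos (-α * T)).le
  rw [← mul_assoc, h2, one_mul] at h3
  have e : 1 / α * (1 - Real.exp (-α * T)) * κ = κ / α - Real.exp (-α * T) * (κ / α) := by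
    field_simp
  rw [e]
  linarith

end AbsolutelyContinuous

/-! ### Consequences of the matrix inequality: the Riccati flow and dissipation. -/

section Setup

open scoped Matrix.Norms.Operator

variable {n p m : ℕ} {A Q : Matrix (Fin n) (Fin n) ℝ} {C : Matrix (Fin p) (Fin n) ℝ}
  {D : Matrix (Fin p) (Fin m) ℝ} {R : Matrix (Fin p) (Fin p) ℝ}

/-- With the gain written as `KRKᵀ`, the quadratic term is symmetric even if `P` is not. Hence `P -
Pᵀ` solves a linear homogeneous equation with zero initial value. -/
lemma IsRiccatiSolution.transpose_eq {P : ℝ → Matrix (Fin n) (Fin n) ℝ} (hQ : Qᵀ = Q)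
    (hR : Rᵀ = R) (hP : IsRiccatiSolution A C Q R P) (hP0 : (P 0)ᵀ = P 0) {t : ℝ} (ht : 0 ≤ t) :
    (P t)ᵀ = P t := by
  have hd : ∀ s, 0 ≤ s → HasDerivWithinAt (fun u => P u - (P u)ᵀ)
      (A * (P s - (P s)ᵀ) + (P s - (P s)ᵀ) * Aᵀ) (Set.Ici 0) s := by
    intro s hs
    have h1 := hasDerivWithinAt_matrix.2 (hP s hs)
    have h2 : HasDerivWithinAt (fun u => (P u)ᵀ)
      (A * P s + P s * Aᵀ + Q - gain C R (P s) * R * (gain C R (P s))ᵀ)ᵀ (Set.Ici 0) s :=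
      hasDerivWithinAt_matrix.2 fun i j => hP s hs j i
    refine (h1.fun_sub h2).congr_deriv ?_
    simp only [Matrix.transpose_sub, Matrix.transpose_add, Matrix.transpose_mul,
      Matrix.transpose_transpose, hQ, hR, Matrix.mul_sub, Matrix.sub_mul, Matrix.mul_assoc]
    abel
  have h0 := eq_zero_of_abs_deriv_le_mul_abs_self_of_eq_zero_right (a := 0) (b := t)
    (K := ‖A‖ + ‖Aᵀ‖)
    (fun s hs => ((hd s hs.1).mono Set.Icc_subset_Ici_self).continuousWithinAt)
    (fun s hs => (hd s hs.1).mono (Set.Ici_subset_Ici.2 hs.1))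
    (by rw [hP0, sub_self])
    (fun s _ => by
      refine (norm_add_le _ _).trans ?_
      rw [add_mul]
      refine add_le_add (norm_mul_le _ _) ((norm_mul_le _ _).trans_eq (mul_comm _ _)))
    t ⟨ht, le_rfl⟩
  exact (sub_eq_zero.1 h0).symm

lemma gain_mul_mul_gain (hR : R.PosDef) {P : Matrix (Fin n) (Fin n) ℝ} (hP : Pᵀ = P) :
    gain C R P * R * (gain C R P)ᵀ = P * (Cᵀ * R⁻¹ * C) * P := by
  have hRi : R⁻¹ * R = 1 := R.nonsing_inv_mul ((Matrix.isUnit_iff_isUnit_det _).1 hR.isUnit)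
  have hRs : R⁻¹ᵀ = R⁻¹ := isHermitian_iff_transpose.1 hR.inv.isHermitian
  simp only [gain, Matrix.transpose_mul, Matrix.transpose_transpose, hP, hRs]
  have : P * Cᵀ * R⁻¹ * R = P * Cᵀ := by rw [Matrix.mul_assoc, hRi, Matrix.mul_one]
  rw [this]
  simp only [Matrix.mul_assoc]

lemma lmi_of_matS {γ2 w : Fin p → ℝ} (hγ2 : ∀ i, 0 < γ2 i) {U : Matrix (Fin m) (Fin m) ℝ} {α : ℝ}
    {P : Matrix (Fin n) (Fin n) ℝ} (hS : (matS C D Q R γ2 w U α P).PosSemidef) :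
    (P⁻¹ * Q * P⁻¹ + Cᵀ * R⁻¹ * C - α • P⁻¹).PosSemidef := by
  have h1 : (matM C Q R γ2 P - α • P⁻¹).PosSemidef := hS.submatrix Sum.inl
  have h2 : (Cᵀ * Matrix.diagonal γ2 * C).PosSemidef :=
    PosSemidef.conj (Matrix.PosSemidef.diagonal fun i => (hγ2 i).le) C
  have e : P⁻¹ * Q * P⁻¹ + Cᵀ * R⁻¹ * C - α • P⁻¹ =
      matM C Q R γ2 P - α • P⁻¹ + Cᵀ * Matrix.diagonal γ2 * C := by
    rw [matM, Matrix.mul_sub, Matrix.sub_mul]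
    abel
  rw [e]
  exact h1.add h2

lemma riccatiFlow (hQ : Q.PosSemidef) (hR : R.PosDef) {γ2 w : Fin p → ℝ}
    (hγ2 : ∀ i, 0 < γ2 i) {U : Matrix (Fin m) (Fin m) ℝ} {α : ℝ} (hα : 0 < α)
    {P : ℝ → Matrix (Fin n) (Fin n) ℝ} (hP0 : (P 0).PosDef) (hP : IsRiccatiSolution A C Q R P)
    (hS : ∀ t, 0 ≤ t → (matS C D Q R γ2 w U α (P t)).PosSemidef) :
    RiccatiFlow A (Cᵀ * R⁻¹ * C) Q α P := by
  have hQs := isHermitian_iff_transpose.1 hQ.isHermitian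
  have hRs := isHermitian_iff_transpose.1 hR.isHermitian
  have hsym : ∀ t, 0 ≤ t → (P t)ᵀ = P t := fun t ht =>
    hP.transpose_eq hQs hRs (isHermitian_iff_transpose.1 hP0.isHermitian) ht
  refine ⟨hα, ?_, hQs, hsym, fun t ht => ?_, fun t ht => lmi_of_matS hγ2 (hS t ht), hP0⟩
  · exact isHermitian_iff_transpose.1 (PosSemidef.conj hR.inv.posSemidef C).isHermitian
  · rw [riccatiField, ← gain_mul_mul_gain hR (hsym t ht)]
    exact hasDerivWithinAt_matrix.2 (hP t ht)

lemma matS_quad {γ2 w : Fin p → ℝ} {U : Matrix (Fin m) (Fin m) ℝ} {α : ℝ}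
    {P : Matrix (Fin n) (Fin n) ℝ} (e : Fin n → ℝ) (z : Fin p → ℝ) (d : Fin m → ℝ) :
    Sum.elim e (Sum.elim z d) ⬝ᵥ (matS C D Q R γ2 w U α P *ᵥ Sum.elim e (Sum.elim z d)) =
      e ⬝ᵥ ((P⁻¹ * Q * P⁻¹) *ᵥ e) + (C *ᵥ e) ⬝ᵥ (R⁻¹ *ᵥ (C *ᵥ e))
        - (C *ᵥ e) ⬝ᵥ (Matrix.diagonal γ2 *ᵥ (C *ᵥ e)) - α * (e ⬝ᵥ (P⁻¹ *ᵥ e))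
        - 2 * ((C *ᵥ e) ⬝ᵥ (R⁻¹ *ᵥ z) + (C *ᵥ e) ⬝ᵥ (Matrix.diagonal w *ᵥ z))
        + 2 * ((C *ᵥ e) ⬝ᵥ (Matrix.diagonal γ2 *ᵥ (D *ᵥ d)) - (C *ᵥ e) ⬝ᵥ (R⁻¹ *ᵥ (D *ᵥ d)))
        + 2 * (z ⬝ᵥ (Matrix.diagonal w *ᵥ z)) + 2 * (z ⬝ᵥ (Matrix.diagonal w *ᵥ (D *ᵥ d)))
        + d ⬝ᵥ (U *ᵥ d) := by
  have hC : ∀ u : Fin p → ℝ, e ⬝ᵥ (Cᵀ *ᵥ u) = (C *ᵥ e) ⬝ᵥ u := fun u => by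
    rw [quad_transpose, dotProduct_comm]
  simp only [matS, matM, Matrix.fromBlocks_mulVec, Sum.elim_comp_inl, Sum.elim_comp_inr,
    sumElim_dotProduct_sumElim, Matrix.fromRows_mulVec, Matrix.fromCols_mulVec_sumElim,
    dotProduct_add, quad_transpose, Matrix.sub_mulVec, Matrix.add_mulVec, Matrix.neg_mulVec,
    Matrix.smul_mulVec, dotProduct_sub, dotProduct_neg, dotProduct_smul, smul_eq_mul,
    Sum.elim_add_add]
  have h1 : e ⬝ᵥ ((Cᵀ * (R⁻¹ - Matrix.diagonal γ2) * C) *ᵥ e) =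
      (C *ᵥ e) ⬝ᵥ (R⁻¹ *ᵥ (C *ᵥ e)) - (C *ᵥ e) ⬝ᵥ (Matrix.diagonal γ2 *ᵥ (C *ᵥ e)) := by
    rw [← Matrix.mulVec_mulVec, ← Matrix.mulVec_mulVec, hC, Matrix.sub_mulVec, dotProduct_sub]
  have h2 : e ⬝ᵥ ((Cᵀ * (R⁻¹ + Matrix.diagonal w)) *ᵥ z) =
      (C *ᵥ e) ⬝ᵥ (R⁻¹ *ᵥ z) + (C *ᵥ e) ⬝ᵥ (Matrix.diagonal w *ᵥ z) := by
    rw [← Matrix.mulVec_mulVec, hC, Matrix.add_mulVec, dotProduct_add]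
  have h3 : e ⬝ᵥ ((Cᵀ * (Matrix.diagonal γ2 - R⁻¹) * D) *ᵥ d) =
      (C *ᵥ e) ⬝ᵥ (Matrix.diagonal γ2 *ᵥ (D *ᵥ d)) - (C *ᵥ e) ⬝ᵥ (R⁻¹ *ᵥ (D *ᵥ d)) := by
    rw [← Matrix.mulVec_mulVec, ← Matrix.mulVec_mulVec, hC, Matrix.sub_mulVec, dotProduct_sub]
  have h4 : z ⬝ᵥ ((Matrix.diagonal w * D) *ᵥ d) = z ⬝ᵥ (Matrix.diagonal w *ᵥ (D *ᵥ d)) := by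
    rw [← Matrix.mulVec_mulVec]
  rw [h1, h2, h3, h4]
  ring

/-- The dead zone `r - sat r` and the saturation have the same sign. -/
lemma sat_sector {s : ℝ} (hs : 0 ≤ s) (r : ℝ) : 0 ≤ (r - sat s r) * sat s r := by
  unfold sat
  rcases le_total s r with h | h
  · rw [min_eq_left h, max_eq_right (by linarith)]
    exact mul_nonneg (by linarith) hs
  · rw [min_eq_right h]
    rcases le_total (-s) r with h' | h'
    · rw [max_eq_right h']; simp
    · rw [max_eq_left h']
      nlinarith

lemma diagonal_quad_comm (w u v : Fin p → ℝ) :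
    u ⬝ᵥ (Matrix.diagonal w *ᵥ v) = v ⬝ᵥ (Matrix.diagonal w *ᵥ u) := by
  rw [← quad_transpose, Matrix.diagonal_transpose]

/-- The dissipation inequality for the quadratic part of the Lyapunov function. -/
lemma quad_dissipation {γ2 w σ : Fin p → ℝ} (hw : ∀ i, 0 < w i) {U : Matrix (Fin m) (Fin m) ℝ}
    {α : ℝ} {P : Matrix (Fin n) (Fin n) ℝ} (hS : (matS C D Q R γ2 w U α P).PosSemidef)
    (e : Fin n → ℝ) (d : Fin m → ℝ) :
    2 * ((C *ᵥ e) ⬝ᵥ (R⁻¹ *ᵥ satVec σ (D *ᵥ d - C *ᵥ e))) - e ⬝ᵥ ((P⁻¹ * Q * P⁻¹) *ᵥ e)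
      + (C *ᵥ e) ⬝ᵥ (R⁻¹ *ᵥ (C *ᵥ e)) + ∑ i, γ2 i * (D *ᵥ d - C *ᵥ e) i ^ 2 ≤
      -α * (e ⬝ᵥ (P⁻¹ *ᵥ e)) + d ⬝ᵥ ((U + Dᵀ * Matrix.diagonal γ2 * D) *ᵥ d) := by
  set a := C *ᵥ e with ha
  set b := D *ᵥ d with hb
  set s := satVec σ (b - a) with hs
  set q := b - a - s with hq
  -- Here `q` is the dead zone of the innovation; the sign of its slot matches the off-diagonal
  -- blocks of `S`.
  have hform := PosSemidef.quad_nonneg hS (Sum.elim e (Sum.elim (-q) d))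
  rw [matS_quad, ← ha, ← hb] at hform
  have hsec : 0 ≤ q ⬝ᵥ (Matrix.diagonal w *ᵥ s) := by
    simp only [dotProduct, Matrix.mulVec_diagonal]
    refine Finset.sum_nonneg fun i _ => ?_
    have := mul_nonneg (hw i).le (sat_sector (Real.sqrt_nonneg (σ i)) ((b - a) i))
    have e1 : q i = (b - a) i - s i := rfl
    have e2 : s i = sat (√(σ i)) ((b - a) i) := rfl
    rw [e1, e2]
    linarith
  have hγ : ∑ i, γ2 i * (b - a) i ^ 2 = (b - a) ⬝ᵥ (Matrix.diagonal γ2 *ᵥ (b - a)) := by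
    simp only [dotProduct, Matrix.mulVec_diagonal]
    exact Finset.sum_congr rfl fun i _ => by ring
  have hD : d ⬝ᵥ ((Dᵀ * Matrix.diagonal γ2 * D) *ᵥ d) = b ⬝ᵥ (Matrix.diagonal γ2 *ᵥ b) := by
    rw [← Matrix.mulVec_mulVec, ← Matrix.mulVec_mulVec, quad_transpose, dotProduct_comm]
  have hsb : s = b - a - q := by rw [hq]; abel
  rw [hγ, Matrix.add_mulVec, dotProduct_add, hD]
  rw [hsb] at hsec ⊢
  simp only [Matrix.mulVec_sub, Matrix.mulVec_neg, dotProduct_sub, sub_dotProduct, dotProduct_neg,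
    neg_dotProduct] at hform hsec ⊢
  rw [diagonal_quad_comm w q a] at hsec
  rw [diagonal_quad_comm γ2 b a]
  -- The right side minus the left side is exactly the form of `S` plus `2 qᵀWs`: the diagonal `W`
  -- acts as the multiplier of the sector condition.
  linarith

end Setup

/-! ### Calculus of Carathéodory solutions. -/

section Solves

lemma Solves.add {f g f' g' : ℝ → ℝ} (hf : Solves f f') (hg : Solves g g') :
    Solves (fun t => f t + g t) (fun t => f' t + g' t) := by
  refine ⟨fun T hT => (hf.1 T hT).fun_add (hg.1 T hT), ?_⟩
  filter_upwards [hf.2, hg.2] with t h1 h2 ht using (h1 ht).fun_add (h2 ht)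

lemma Solves.sub {f g f' g' : ℝ → ℝ} (hf : Solves f f') (hg : Solves g g') :
    Solves (fun t => f t - g t) (fun t => f' t - g' t) := by
  refine ⟨fun T hT => (hf.1 T hT).fun_sub (hg.1 T hT), ?_⟩
  filter_upwards [hf.2, hg.2] with t h1 h2 ht using (h1 ht).fun_sub (h2 ht)

lemma Solves.mul {f g f' g' : ℝ → ℝ} (hf : Solves f f') (hg : Solves g g') :
    Solves (fun t => f t * g t) (fun t => f' t * g t + f t * g' t) := by
  refine ⟨fun T hT => (hf.1 T hT).fun_mul (hg.1 T hT), ?_⟩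
  filter_upwards [hf.2, hg.2] with t h1 h2 ht using (h1 ht).fun_mul (h2 ht)

lemma Solves.sum {ι : Type*} [Fintype ι] {f f' : ι → ℝ → ℝ} (h : ∀ i, Solves (f i) (f' i)) :
    Solves (fun t => ∑ i, f i t) (fun t => ∑ i, f' i t) := by
  refine ⟨fun T hT => absolutelyContinuous_sum _ fun i _ => (h i).1 T hT, ?_⟩
  filter_upwards [ae_all_iff.2 fun i => (h i).2] with t ht ht0
  exact HasDerivAt.fun_sum fun i _ => ht i ht0

lemma Solves.of_hasDerivWithinAt {f f' : ℝ → ℝ}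
    (hf : ∀ t, 0 ≤ t → HasDerivWithinAt f (f' t) (Set.Ici 0) t)
    (hf' : ContinuousOn f' (Set.Ici 0)) : Solves f f' := by
  refine ⟨fun T hT => absolutelyContinuous_of_hasDerivWithinAt hf hf' hT, ?_⟩
  filter_upwards [Measure.ae_ne volume 0] with t hne ht
  exact (hf t ht).hasDerivAt (Ici_mem_nhds (lt_of_le_of_ne ht hne.symm))

lemma Solves.congr {f g g' : ℝ → ℝ} (h : Solves f g) (hg : ∀ t, g t = g' t) : Solves f g' :=
  funext hg ▸ h

/-- Derivative of the quadratic form `eᵀ X e` along Carathéodory solutions. -/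
lemma Solves.quad {n : ℕ} {X X' : ℝ → Matrix (Fin n) (Fin n) ℝ} {e e' : ℝ → Fin n → ℝ}
    (hX : ∀ i j, Solves (fun t => X t i j) (fun t => X' t i j))
    (he : ∀ i, Solves (fun t => e t i) (fun t => e' t i)) :
    Solves (fun t => e t ⬝ᵥ (X t *ᵥ e t)) (fun t =>
      e' t ⬝ᵥ (X t *ᵥ e t) + e t ⬝ᵥ (X' t *ᵥ e t + X t *ᵥ e' t)) := by
  refine (Solves.sum fun i => (he i).mul (Solves.sum fun j => (hX i j).mul (he j))).congr
    fun t => ?_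
  simp only [dotProduct, Matrix.mulVec, Pi.add_apply, Finset.sum_add_distrib]

end Solves

/-! ### The Lyapunov estimate and the ultimate bound. -/

section Lyapunov

open scoped Matrix.Norms.Operator

variable {n p m : ℕ} {A Q : Matrix (Fin n) (Fin n) ℝ} {C : Matrix (Fin p) (Fin n) ℝ}
  {D : Matrix (Fin p) (Fin m) ℝ} {R : Matrix (Fin p) (Fin p) ℝ}

lemma RiccatiFlow.solves_inv {G : Matrix (Fin n) (Fin n) ℝ} {α : ℝ}
    {P : ℝ → Matrix (Fin n) (Fin n) ℝ} (h : RiccatiFlow A G Q α P) (i j : Fin n) :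
    Solves (fun t => (P t)⁻¹ i j)
      (fun t => (-((P t)⁻¹ * riccatiField A G Q (P t) * (P t)⁻¹)) i j) := by
  have hX : ∀ t, 0 ≤ t → HasDerivWithinAt (fun u => (P u)⁻¹)
      (-((P t)⁻¹ * riccatiField A G Q (P t) * (P t)⁻¹)) (Set.Ici 0) t := fun t ht =>
    hasDerivWithinAt_matrix_inv (h.deriv t ht) (h.posDef ht).isUnit
  refine Solves.of_hasDerivWithinAt (fun t ht => hasDerivWithinAt_matrix.1 (hX t ht) i j) ?_
  have hXc : ContinuousOn (fun t => (P t)⁻¹) (Set.Ici 0) := fun t ht =>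
    (hX t ht).continuousWithinAt
  have hPc : ContinuousOn P (Set.Ici 0) := fun t ht => (h.deriv t ht).continuousWithinAt
  have hZc : ContinuousOn (fun t => riccatiField A G Q (P t)) (Set.Ici 0) := by
    unfold riccatiField; fun_prop
  have hc : ContinuousOn (fun t => -((P t)⁻¹ * riccatiField A G Q (P t) * (P t)⁻¹)) (Set.Ici 0) :=
    ((hXc.mul hZc).mul hXc).neg
  exact continuousOn_pi.1 (continuousOn_pi.1 hc i) j

/-- The derivative of `P⁻¹` contributes `-(P⁻¹A + AᵀP⁻¹)`, which cancels the plant dynamics, and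
`P⁻¹K = CᵀR⁻¹` expresses the rest through `Ce`. -/
lemma quad_derivative_eq {P : Matrix (Fin n) (Fin n) ℝ} (hP : P.PosDef)
    (e : Fin n → ℝ) (s : Fin p → ℝ) :
    (A *ᵥ e + gain C R P *ᵥ s) ⬝ᵥ (P⁻¹ *ᵥ e) +
      e ⬝ᵥ ((-(P⁻¹ * riccatiField A (Cᵀ * R⁻¹ * C) Q P * P⁻¹)) *ᵥ e +
        P⁻¹ *ᵥ (A *ᵥ e + gain C R P *ᵥ s)) =
    2 * ((C *ᵥ e) ⬝ᵥ (R⁻¹ *ᵥ s)) - e ⬝ᵥ ((P⁻¹ * Q * P⁻¹) *ᵥ e)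
      + (C *ᵥ e) ⬝ᵥ (R⁻¹ *ᵥ (C *ᵥ e)) := by
  set X := P⁻¹ with hX
  have hPX : P * X = 1 := P.mul_nonsing_inv ((Matrix.isUnit_iff_isUnit_det _).1 hP.isUnit)
  have hXP : X * P = 1 := P.nonsing_inv_mul ((Matrix.isUnit_iff_isUnit_det _).1 hP.isUnit)
  have hXs : Xᵀ = X := isHermitian_iff_transpose.1 hP.inv.isHermitian
  have hC : ∀ u : Fin p → ℝ, e ⬝ᵥ (Cᵀ *ᵥ u) = (C *ᵥ e) ⬝ᵥ u := fun u => by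
    rw [quad_transpose, dotProduct_comm]
  have h1 : X * riccatiField A (Cᵀ * R⁻¹ * C) Q P * X =
      X * A + Aᵀ * X + X * Q * X - Cᵀ * R⁻¹ * C := by
    have : X * riccatiField A (Cᵀ * R⁻¹ * C) Q P * X = X * A * (P * X) + (X * P) * (Aᵀ * X)
        + X * Q * X - (X * P) * (Cᵀ * R⁻¹ * C) * (P * X) := by unfold riccatiField; noncomm_ring
    rw [this, hPX, hXP]
    simp only [Matrix.mul_one, Matrix.one_mul]
  have h2 : (A *ᵥ e + gain C R P *ᵥ s) ⬝ᵥ (X *ᵥ e) =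
      e ⬝ᵥ (X *ᵥ (A *ᵥ e + gain C R P *ᵥ s)) := by
    rw [← quad_transpose, hXs]
  have h3 : e ⬝ᵥ (X *ᵥ (gain C R P *ᵥ s)) = (C *ᵥ e) ⬝ᵥ (R⁻¹ *ᵥ s) := by
    have : X * gain C R P = Cᵀ * R⁻¹ := by
      rw [gain, ← Matrix.mul_assoc, ← Matrix.mul_assoc, hXP, Matrix.one_mul]
    rw [Matrix.mulVec_mulVec, this, ← Matrix.mulVec_mulVec, hC]
  have h4 : e ⬝ᵥ ((Aᵀ * X) *ᵥ e) = e ⬝ᵥ ((X * A) *ᵥ e) := by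
    rw [← quad_transpose, Matrix.transpose_mul, Matrix.transpose_transpose, hXs]
  have h5 : e ⬝ᵥ ((Cᵀ * R⁻¹ * C) *ᵥ e) = (C *ᵥ e) ⬝ᵥ (R⁻¹ *ᵥ (C *ᵥ e)) := by
    rw [← Matrix.mulVec_mulVec, ← Matrix.mulVec_mulVec, hC]
  rw [h2, h1]
  simp only [Matrix.mulVec_add, dotProduct_add, Matrix.neg_mulVec, dotProduct_neg,
    Matrix.sub_mulVec, Matrix.add_mulVec, dotProduct_sub, h3, h4, h5]
  rw [Matrix.mulVec_mulVec]
  ring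

/-- Equivalent to `x ≤ e^{x-1}`, the tangent line inequality for the exponential at `0`. -/
lemma mul_exp_neg_le (x : ℝ) : x * Real.exp (-x) ≤ Real.exp (-1) := by
  have h1 := Real.add_one_le_exp (x - 1)
  have h2 : Real.exp (x - 1) * Real.exp (-x) = Real.exp (-1) := by
    rw [← Real.exp_add]; ring_nf
  rw [← h2]
  exact mul_le_mul_of_nonneg_right (by linarith) (Real.exp_pos _).le

lemma innovation_eq (x xhat : Fin n → ℝ) (d : Fin m → ℝ) :
    output C D x d - C *ᵥ xhat = D *ᵥ d - C *ᵥ (xhat - x) := by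
  rw [output, Matrix.mulVec_sub]; abel

lemma outlier_le {U : Matrix (Fin m) (Fin m) ℝ} (hU : U.PosDef) {γ2 : Fin p → ℝ}
    (hγ2 : ∀ i, 0 < γ2 i) {d : Fin m → ℝ} {μ : ℝ} (hd : norm2 d ≤ μ) :
    d ⬝ᵥ ((U + Dᵀ * Matrix.diagonal γ2 * D) *ᵥ d) ≤ c₁ D γ2 U * μ ^ 2 := by
  have h : (U + Dᵀ * Matrix.diagonal γ2 * D).PosSemidef := hU.posSemidef.add
    (PosSemidef.conj (Matrix.PosSemidef.diagonal fun i => (hγ2 i).le) D)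
  refine (quad_le_maxEig_mul h.isHermitian d).trans ?_
  exact mul_le_mul_of_nonneg_left (pow_le_pow_left₀ (norm2_nonneg d) hd 2) (maxEig_nonneg h)

variable {lam1 lam2 γ1 γ2 : Fin p → ℝ} {P : ℝ → Matrix (Fin n) (Fin n) ℝ} {d : ℝ → Fin m → ℝ}
  {x xhat : ℝ → Fin n → ℝ} {σ ε : ℝ → Fin p → ℝ}

lemma IsTrajectory.monitor_pos (h : IsTrajectory A C D R lam1 lam2 γ1 γ2 P d x xhat σ ε)
    (hγ2 : ∀ i, 0 < γ2 i) {t : ℝ} (ht : 0 ≤ t) (i : Fin p) : 0 < ε t i :=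
  (h.monitor i).pos (lam2 i)
    (fun _ _ => le_add_of_nonneg_right (mul_nonneg (hγ2 i).le (sq_nonneg _)))
    (h.monitor_init i) ht

lemma IsTrajectory.bound_pos (h : IsTrajectory A C D R lam1 lam2 γ1 γ2 P d x xhat σ ε)
    (hγ1 : ∀ i, 0 < γ1 i) (hγ2 : ∀ i, 0 < γ2 i) {t : ℝ} (ht : 0 ≤ t) (i : Fin p) : 0 < σ t i :=
  (h.bound i).pos (lam1 i)
    (fun t ht => by
      have := mul_pos (mul_pos (hγ1 i) (h.monitor_pos hγ2 ht i)) (Real.exp_pos (-(ε t i)))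
      linarith) (h.bound_init i) ht

/-- The Lyapunov function decays exponentially up to the size of the outliers and of the
excitation of the saturation bounds. -/
lemma IsTrajectory.lyap_le (h : IsTrajectory A C D R lam1 lam2 γ1 γ2 P d x xhat σ ε)
    (hγ1 : ∀ i, 0 < γ1 i) (hγ2 : ∀ i, 0 < γ2 i) {α : ℝ}
    (hflow : RiccatiFlow A (Cᵀ * R⁻¹ * C) Q α P)
    {μ : ℝ} (hd : ∀ t, 0 ≤ t → norm2 (d t) ≤ μ) {w : Fin p → ℝ} (hw : ∀ i, 0 < w i)
    {U : Matrix (Fin m) (Fin m) ℝ} (hU : U.PosDef) (hαlam : ∀ i, α ≤ -max (lam1 i) (lam2 i))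
    (hS : ∀ t, 0 ≤ t → (matS C D Q R γ2 w U α (P t)).PosSemidef) {t : ℝ} (ht : 0 ≤ t) :
    lyap (P t) (xhat t - x t) (σ t) (ε t) ≤
      Real.exp (-α * t) * lyap (P 0) (xhat 0 - x 0) (σ 0) (ε 0) +
        1 / α * (1 - Real.exp (-α * t)) * (c₁ D γ2 U * μ ^ 2 + rho γ1) := by
  have he : ∀ i, Solves (fun t => (xhat t - x t) i) (fun t =>
      (A *ᵥ (xhat t - x t) + gain C R (P t) *ᵥ
        satVec (σ t) (D *ᵥ d t - C *ᵥ (xhat t - x t))) i) := by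
    intro i
    refine ((h.estimate i).sub (h.state i)).congr fun t => ?_
    rw [innovation_eq, Matrix.mulVec_sub A]
    simp only [Pi.add_apply, Pi.sub_apply]
    ring
  have hV := ((Solves.quad hflow.solves_inv he).add (Solves.sum h.bound)).add
    (Solves.sum h.monitor)
  refine hV.gronwall hflow.pos (fun t ht => ?_) ht
  have ht' := ht.le
  rw [quad_derivative_eq (hflow.posDef ht')]
  simp only [innovation_eq]
  have h1 := quad_dissipation (σ := σ t) hw (hS t ht') (xhat t - x t) (d t)
  have h2 := outlier_le (D := D) hU hγ2 (hd t ht')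
  have h3 : ∑ i, (lam1 i * σ t i + γ1 i * ε t i * Real.exp (-(ε t i))) ≤
      -α * ∑ i, σ t i + rho γ1 := by
    rw [rho, Finset.mul_sum, Finset.mul_sum, ← Finset.sum_add_distrib]
    refine Finset.sum_le_sum fun i _ => ?_
    have a1 : lam1 i ≤ -α := by linarith [hαlam i, le_max_left (lam1 i) (lam2 i)]
    have a2 := mul_le_mul_of_nonneg_right a1 (h.bound_pos hγ1 hγ2 ht' i).le
    have a3 := mul_le_mul_of_nonneg_left (mul_exp_neg_le (ε t i)) (hγ1 i).le
    linarith
  -- The squared innovations are kept, since they occur identically on the left of `h1` and are paid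
  -- for there.
  have h4 : ∑ i, (lam2 i * ε t i + γ2 i * (D *ᵥ d t - C *ᵥ (xhat t - x t)) i ^ 2) ≤
      -α * ∑ i, ε t i + ∑ i, γ2 i * (D *ᵥ d t - C *ᵥ (xhat t - x t)) i ^ 2 := by
    rw [Finset.sum_add_distrib, Finset.mul_sum]
    refine add_le_add_left (Finset.sum_le_sum fun i _ => ?_) _
    have a1 : lam2 i ≤ -α := by linarith [hαlam i, le_max_right (lam1 i) (lam2 i)]
    exact mul_le_mul_of_nonneg_right a1 (h.monitor_pos hγ2 ht' i).le
  linarith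

lemma IsTrajectory.quad_le_lyap (h : IsTrajectory A C D R lam1 lam2 γ1 γ2 P d x xhat σ ε)
    (hγ1 : ∀ i, 0 < γ1 i) (hγ2 : ∀ i, 0 < γ2 i) {t : ℝ} (ht : 0 ≤ t) :
    (xhat t - x t) ⬝ᵥ ((P t)⁻¹ *ᵥ (xhat t - x t)) ≤ lyap (P t) (xhat t - x t) (σ t) (ε t) := by
  have h1 := Finset.sum_nonneg fun i (_ : i ∈ Finset.univ) => (h.bound_pos hγ1 hγ2 ht i).le
  have h2 := Finset.sum_nonneg fun i (_ : i ∈ Finset.univ) => (h.monitor_pos hγ2 ht i).le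
  rw [lyap]
  linarith

lemma tendsto_matrix_inv {ι : Type*} {F : Filter ι} {f : ι → Matrix (Fin n) (Fin n) ℝ}
    {M : Matrix (Fin n) (Fin n) ℝ} (hf : Tendsto f F (𝓝 M)) (hM : IsUnit M) :
    Tendsto (fun i => (f i)⁻¹) F (𝓝 M⁻¹) := by
  obtain ⟨u, rfl⟩ := hM
  have h := (hasFDerivAt_ringInverse (𝕜 := ℝ) u).continuousAt.tendsto.comp hf
  rw [Matrix.nonsing_inv_eq_ringInverse]
  exact h.congr fun i => (Matrix.nonsing_inv_eq_ringInverse _).symm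

/-- The matrix inequality passes to the limit. -/
lemma RiccatiFlow.lmi_limit {G : Matrix (Fin n) (Fin n) ℝ} {α : ℝ} (h : RiccatiFlow A G Q α P)
    {Pinf : Matrix (Fin n) (Fin n) ℝ} (hlim : Tendsto P atTop (𝓝 Pinf)) (hpd : Pinf.PosDef) :
    (Pinf⁻¹ * Q * Pinf⁻¹ + G - α • Pinf⁻¹).PosSemidef := by
  have hX := tendsto_matrix_inv hlim hpd.isUnit
  have hXs : (Pinf⁻¹)ᵀ = Pinf⁻¹ := isHermitian_iff_transpose.1 hpd.inv.isHermitian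
  refine posSemidef_of_quad ?_ fun v => ?_
  · simp only [Matrix.transpose_sub, Matrix.transpose_add, Matrix.transpose_mul,
      Matrix.transpose_smul, hXs, h.symG, h.symQ, Matrix.mul_assoc]
  · have hc : Continuous fun M : Matrix (Fin n) (Fin n) ℝ =>
        v ⬝ᵥ ((M * Q * M + G - α • M) *ᵥ v) := by fun_prop
    refine ge_of_tendsto ((hc.tendsto _).comp hX) ?_
    filter_upwards [eventually_ge_atTop 0] with t ht
    exact PosSemidef.quad_nonneg (h.lmi t ht) v

/-- A vector whose weighted squares `eᵀ X_t e` are eventually dominated by a convergent function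
is ultimately bounded, with the smallest eigenvalue of the limit weight. -/
lemma limsup_norm2_le {e : ℝ → Fin n → ℝ} {X : ℝ → Matrix (Fin n) (Fin n) ℝ}
    {Y : Matrix (Fin n) (Fin n) ℝ} (hX : Tendsto X atTop (𝓝 Y)) (hY : Y.PosDef) {b : ℝ → ℝ} {l : ℝ}
    (hb : Tendsto b atTop (𝓝 l)) (h : ∀ᶠ t in atTop, e t ⬝ᵥ (X t *ᵥ e t) ≤ b t) :
    IsBoundedUnder (· ≤ ·) atTop (fun t => norm2 (e t)) ∧
      limsup (fun t => norm2 (e t)) atTop ≤ √(l / minEig Y) := by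
  have hex : ∃ u : ℝ → ℝ, Tendsto u atTop (𝓝 √(l / minEig Y)) ∧
      ∀ᶠ t in atTop, norm2 (e t) ≤ u t := by
    rcases Nat.eq_zero_or_pos n with rfl | hn
    · refine ⟨fun _ => _, tendsto_const_nhds, .of_forall fun t => ?_⟩
      have : norm2 (e t) ^ 2 = 0 := by rw [norm2_sq]; simp
      rw [pow_eq_zero_iff two_ne_zero |>.1 this]
      positivity
    have : NeZero n := ⟨hn.ne'⟩
    have hc := minEig_pos hY
    set δ : ℝ → ℝ := fun t => ∑ i, ∑ j, |X t i j - Y i j| with hδ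
    have hd : Tendsto δ atTop (𝓝 0) := by
      have hcont : Continuous fun N : Matrix (Fin n) (Fin n) ℝ => ∑ i, ∑ j, |N i j - Y i j| := by
        fun_prop
      simpa using! (hcont.tendsto Y).comp hX
    have hden : Tendsto (fun t => minEig Y - δ t) atTop (𝓝 (minEig Y)) := by
      simpa using tendsto_const_nhds.sub hd
    -- The weight `X t` dominates `minEig Y - δ t` times the identity, and `δ` tends to `0`.
    refine ⟨fun t => √(b t / (minEig Y - δ t)),
      (Real.continuous_sqrt.tendsto _).comp (hb.div hden hc.ne'), ?_⟩
    filter_upwards [h, hden.eventually_const_lt hc] with t h1 h2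
    refine Real.le_sqrt_of_sq_le ?_
    rw [le_div_iff₀ h2]
    have h3 := minEig_mul_le_quad hY.isHermitian (e t)
    have h4 := (abs_le.1 (abs_quad_sub_le (X t) Y (e t))).1
    linarith
  obtain ⟨u, hu, hle⟩ := hex
  refine ⟨hu.isBoundedUnder_le.mono_le hle, ?_⟩
  rw [← hu.limsup_eq]
  exact limsup_le_limsup hle
    (isCoboundedUnder_le_of_le atTop (x := 0) fun t => norm2_nonneg _) hu.isBoundedUnder_le

end Lyapunov

end ISKF

theorem theorem1 {n p m : ℕ}
    (A : Matrix (Fin n) (Fin n) ℝ) (C : Matrix (Fin p) (Fin n) ℝ) (D : Matrix (Fin p) (Fin m) ℝ)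
    (Q : Matrix (Fin n) (Fin n) ℝ) (R : Matrix (Fin p) (Fin p) ℝ)
    (hQ : Q.PosSemidef) (hR : R.PosDef)
    (hstab : ISKF.IsStabilizable A (ISKF.sqrtMat Q)) (hdet : ISKF.IsDetectable A C)
    (lam1 lam2 γ1 γ2 : Fin p → ℝ) (hγ1 : ∀ i, 0 < γ1 i) (hγ2 : ∀ i, 0 < γ2 i)
    -- the Riccati equation of the filter
    (P : ℝ → Matrix (Fin n) (Fin n) ℝ) (hP0 : (P 0).PosDef)
    (hP : ISKF.IsRiccatiSolution A C Q R P)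
    -- the bounded outlier, and a trajectory of the plant and the filter
    (d : ℝ → Fin m → ℝ) (μ : ℝ) (hd : ∀ t, 0 ≤ t → ISKF.norm2 (d t) ≤ μ)
    (x xhat : ℝ → Fin n → ℝ) (σ ε : ℝ → Fin p → ℝ)
    (htraj : ISKF.IsTrajectory A C D R lam1 lam2 γ1 γ2 P d x xhat σ ε)
    -- the design parameters `W = diag w`, `U`, `α`
    (w : Fin p → ℝ) (hw : ∀ i, 0 < w i) (U : Matrix (Fin m) (Fin m) ℝ) (hU : U.PosDef)
    (α : ℝ) (hα : 0 < α) (hαlam : ∀ i, α ≤ -max (lam1 i) (lam2 i))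
    (hS : ∀ t, 0 ≤ t → (ISKF.matS C D Q R γ2 w U α (P t)).PosSemidef) :
    (∀ t, 0 ≤ t → (P t).PosDef ∧
      ISKF.norm2 (xhat t - x t) ≤ Real.sqrt (1 / ISKF.minEig (P t)⁻¹ *
        (Real.exp (-α * t) * ISKF.lyap (P 0) (xhat 0 - x 0) (σ 0) (ε 0) +
          1 / α * (1 - Real.exp (-α * t)) * (ISKF.c₁ D γ2 U * μ ^ 2 + ISKF.rho γ1)))) ∧
    ∃ Pinf : Matrix (Fin n) (Fin n) ℝ,
      (ISKF.IsPosDefARESolution A C Q R Pinf ∧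
        ∀ X, ISKF.IsPosDefARESolution A C Q R X → X = Pinf) ∧
      Tendsto P atTop (𝓝 Pinf) ∧
      IsBoundedUnder (· ≤ ·) atTop (fun t => ISKF.norm2 (xhat t - x t)) ∧
      limsup (fun t => ISKF.norm2 (xhat t - x t)) atTop ≤
        Real.sqrt ((ISKF.c₁ D γ2 U * μ ^ 2 + ISKF.rho γ1) / (α * ISKF.minEig Pinf⁻¹)) := by
  have hflow := ISKF.riccatiFlow hQ hR hγ2 hα hP0 hP hS
  have hV := fun t (ht : 0 ≤ t) => (htraj.quad_le_lyap hγ1 hγ2 ht).trans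
    (htraj.lyap_le hγ1 hγ2 hflow hd hw hU hαlam hS ht)
  refine ⟨fun t ht => ⟨hflow.posDef ht, ?_⟩, ?_⟩
  -- In dimension zero `minEig` is `0` and cannot be divided by, but the error vanishes.
  · rcases Nat.eq_zero_or_pos n with rfl | hn
    · have : ISKF.norm2 (xhat t - x t) ^ 2 = 0 := by rw [ISKF.norm2_sq]; simp
      rw [pow_eq_zero_iff two_ne_zero |>.1 this]
      exact Real.sqrt_nonneg _
    have : NeZero n := ⟨hn.ne'⟩
    have hc := ISKF.minEig_pos (hflow.posDef ht).inv
    refine Real.le_sqrt_of_sq_le ?_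
    rw [one_div_mul_eq_div, le_div_iff₀ hc, mul_comm]
    exact (ISKF.minEig_mul_le_quad (hflow.posDef ht).inv.isHermitian _).trans (hV t ht)
  · obtain ⟨Pinf, hlim, hpd, hare⟩ := hflow.exists_tendsto
    have hG : (Cᵀ * R⁻¹ * C).PosSemidef := ISKF.PosSemidef.conj hR.inv.posSemidef C
    have hfield : ∀ X, A * X + X * Aᵀ + Q - X * Cᵀ * R⁻¹ * C * X =
        ISKF.riccatiField A (Cᵀ * R⁻¹ * C) Q X := fun X => by
      simp only [ISKF.riccatiField, Matrix.mul_assoc]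
    refine ⟨Pinf, ⟨⟨hpd, (hfield Pinf).trans hare⟩, fun X hX => ?_⟩, hlim, ?_⟩
    · exact ISKF.riccati_unique hα hG hQ hpd hX.1 (hflow.lmi_limit hlim hpd) hare
        ((hfield X).symm.trans hX.2)
    · have he : Tendsto (fun t : ℝ => Real.exp (-α * t)) atTop (𝓝 0) :=
        Real.tendsto_exp_atBot.comp (tendsto_id.const_mul_atTop_of_neg (by linarith))
      have hb := (he.mul_const (ISKF.lyap (P 0) (xhat 0 - x 0) (σ 0) (ε 0))).add
        (((he.const_sub 1).const_mul (1 / α)).mul_const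
          (ISKF.c₁ D γ2 U * μ ^ 2 + ISKF.rho γ1))
      have hl : 0 * ISKF.lyap (P 0) (xhat 0 - x 0) (σ 0) (ε 0) +
          1 / α * (1 - 0) * (ISKF.c₁ D γ2 U * μ ^ 2 + ISKF.rho γ1) =
          (ISKF.c₁ D γ2 U * μ ^ 2 + ISKF.rho γ1) / α := by ring
      rw [hl] at hb
      -- Dividing first by `α` exhibits the numerator as the limit `l` of the bound on `V`.
      rw [← div_div]
      exact ISKF.limsup_norm2_le (ISKF.tendsto_matrix_inv hlim hpd.isUnit) hpd.inv hb
        ((eventually_ge_atTop 0).mono hV)
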